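/- Let $d\ge 1$ be an integer, let $1\le p<\infty$, let $\Omega\subset\mathbb{R}^d$ be compact and convex, and let $\rho\in L^1(\Omega)$ be positive almost everywhere on $\Omega$. For a finite set $X\subset\mathbb{R}^d$ and $x\in X$, let \[V_x(X)=\{y\in\Omega : |y-x|\le |y-z| \text{ for all } z\in X\},\qquad \mathscr{E}^p_X(x)=\int_{V_x(X)}|y-x|^p\rho(y)\,\mathrm{d}y,\qquad \mathscr{E}^p(X)=\sum_{x\in X}\mathscr{E}^p_X(x)\] be the Voronoi cell of $x$, the $L^p$ energy of the point $x$, and the $L^p$ energy of $X$, where $|\cdot|$ is the Euclidean norm. For each $N$, let $X^N$ be a set of exactly $N$ points which minimizes $\mathscr{E}^p$ among all sets of exactly $N$ points of $\mathbb{R}^d$. Then there is a real number $L$ such that, for every closed cube $A\subset\Omega$ of positive side length (in any orientation), the set $X^N\cap A$ is non-empty for all large enough $N$, and the average energy of the points of $X^N$ that lie in $A$, \[\bar{\mathscr{E}}^p_A(N)=\frac{1}{\#(X^N\cap A)}\sum_{x\in X^N\cap A}\mathscr{E}^p_{X^N}(x),\] satisfies \[\lim_{N\to\infty}\bar{\mathscr{E}}^p_A(N)\,N^{\frac{d+p}{d}}=L.\]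 In particular the limit exists and does not depend on $A$. -/

import Mathlib

open MeasureTheory Filter Topology

noncomputable section

/-- The Voronoi cell in `Ω` of the generating point `x` of the finite set `X`. -/
def voronoiCell {d : ℕ} (Ω : Set (EuclideanSpace ℝ (Fin d)))
    (X : Finset (EuclideanSpace ℝ (Fin d))) (x : EuclideanSpace ℝ (Fin d)) :
    Set (EuclideanSpace ℝ (Fin d)) :=
  {y | y ∈ Ω ∧ ∀ z ∈ X, ‖y - x‖ ≤ ‖y - z‖}

/-- The `L^p` energy of the generating point `x` of `X`: the integral over its Voronoi cell of
`|y - x|^p ρ(y)`. -/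
def cellEnergy {d : ℕ} (Ω : Set (EuclideanSpace ℝ (Fin d)))
    (ρ : EuclideanSpace ℝ (Fin d) → ℝ) (p : ℝ)
    (X : Finset (EuclideanSpace ℝ (Fin d))) (x : EuclideanSpace ℝ (Fin d)) : ℝ :=
  ∫ y in voronoiCell Ω X x, ‖y - x‖ ^ p * ρ y

/-- The `L^p` energy of the finite set `X`: the sum of the energies of its points. -/
def energy {d : ℕ} (Ω : Set (EuclideanSpace ℝ (Fin d)))
    (ρ : EuclideanSpace ℝ (Fin d) → ℝ) (p : ℝ)
    (X : Finset (EuclideanSpace ℝ (Fin d))) : ℝ :=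
  ∑ x ∈ X, cellEnergy Ω ρ p X x

/-- `X` is a set of exactly `N` points of `ℝ^d` that minimizes the `L^p` energy among all
sets of `N` points. -/
structure IsEnergyMinimizer {d : ℕ} (Ω : Set (EuclideanSpace ℝ (Fin d)))
    (ρ : EuclideanSpace ℝ (Fin d) → ℝ) (p : ℝ) (N : ℕ)
    (X : Finset (EuclideanSpace ℝ (Fin d))) : Prop where
  card_eq : X.card = N
  energy_le : ∀ Y : Finset (EuclideanSpace ℝ (Fin d)), Y.card = N →
    energy Ω ρ p X ≤ energy Ω ρ p Y

/-- A closed cube of positive side length, in any position and orientation. -/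
def IsCube {d : ℕ} (A : Set (EuclideanSpace ℝ (Fin d))) : Prop :=
  ∃ s : ℝ, 0 < s ∧ ∃ φ : EuclideanSpace ℝ (Fin d) ≃ᵢ EuclideanSpace ℝ (Fin d),
    A = φ '' {x | ∀ i, x i ∈ Set.Icc (0 : ℝ) s}

open Classical in
/-- The points of `X` that lie in `A`. -/
def pointsIn {d : ℕ} (X : Finset (EuclideanSpace ℝ (Fin d)))
    (A : Set (EuclideanSpace ℝ (Fin d))) : Finset (EuclideanSpace ℝ (Fin d)) :=
  X.filter (fun x => x ∈ A)

/-- The average energy of the generating points of `X` that lie in `A` (the cells are those of the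
tessellation of `Ω` by the whole set `X`). -/
def averageEnergy {d : ℕ} (Ω : Set (EuclideanSpace ℝ (Fin d)))
    (ρ : EuclideanSpace ℝ (Fin d) → ℝ) (p : ℝ)
    (X : Finset (EuclideanSpace ℝ (Fin d))) (A : Set (EuclideanSpace ℝ (Fin d))) : ℝ :=
  (∑ x ∈ pointsIn X A, cellEnergy Ω ρ p X x) / ((pointsIn X A).card : ℝ)

end

open scoped ENNReal NNReal

noncomputable section

namespace Quantization

/-! Write α = p/d, q = d/(d+p) and λ = ∫ ρ^q. The global input is Zador's theorem: N^α times the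
minimal energy tends to C λ^(1+α), with C = `zadorConst d p` positive and finite.

To localize, split Ω into A and its complement, and let s and t be the integrals of ρ^q over the two
parts, so that s + t = λ. Let x be the fraction of the points of X^N lying in A, and a, b the
energies of the points inside and outside A, multiplied by N^α. Zador's theorem on compact subsets
of each part gives, asymptotically, a x^α ≥ C s^(1+α) and b (1-x)^α ≥ C t^(1+α), while a + b → C
(s+t)^(1+α). By strict convexity s^(1+α) x^(-α) + t^(1+α) (1-x)^(-α) is at least (s+t)^(1+α), with
equality only at x = s/(s+t). Hence nothing is lost in either bound: x → s/λ and a → C s λ^α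
(`share_eq`, `tendsto_share`). The normalized average energy is a/x → C λ^(1+α), from which A has
dropped out.

Zador's theorem (`isZador_indicator`) rests on three facts. For a cube, subdivision into similar
copies makes the rescaled error almost decreasing, so it converges to its infimum. The formula is
additive over disjoint compact supports (`IsZador.add_of_disjoint`): boundedly many extra points
decouple the two problems, and the best division of the points is governed by the same convexity.
Finally it survives L¹ approximation on a bounded domain (`isZador_of_tendsto`), because a density
of small mass is served cheaply by a small fraction of the points (`sqerr_le_lintegral`). This leads
from cubes to measurable sets and then to integrable densities.

The number of points allowed in `qerr` is a real number, so that fractions θt of the points need no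
rounding. -/

/-- Euclidean space of dimension `d`. -/
abbrev Euc (d : ℕ) := EuclideanSpace ℝ (Fin d)

variable {d : ℕ} {p : ℝ}

/-! ### Quantization error: subadditivity and scaling -/

/-- The quantization error: the least `L^p` cost of approximating the density `f` by at most `t`
points. -/
def qerr (p t : ℝ) (f : Euc d → ℝ≥0∞) : ℝ≥0∞ :=
  ⨅ (X : Finset (Euc d)) (_ : (X.card : ℝ) ≤ t), ∫⁻ y, Metric.infEDist y X ^ p * f y

/-- The quantization error rescaled by its natural order. -/
def sqerr (p t : ℝ) (f : Euc d → ℝ≥0∞) : ℝ≥0∞ :=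
  ENNReal.ofReal (t ^ (p / d)) * qerr p t f

/-- The `L^{d/(d+p)}` quasi-norm of a density. -/
def qmass (p : ℝ) (f : Euc d → ℝ≥0∞) : ℝ≥0∞ :=
  (∫⁻ y, f y ^ ((d : ℝ) / (d + p))) ^ (((d : ℝ) + p) / d)

theorem qerr_le {t : ℝ} (f : Euc d → ℝ≥0∞) (X : Finset (Euc d)) (hX : (X.card : ℝ) ≤ t) :
    qerr p t f ≤ ∫⁻ y, Metric.infEDist y X ^ p * f y :=
  iInf₂_le X hX

theorem qerr_anti {s t : ℝ} (h : s ≤ t) (f : Euc d → ℝ≥0∞) : qerr p t f ≤ qerr p s f :=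
  le_iInf₂ fun X hX => qerr_le f X (hX.trans h)

theorem qerr_mono {t : ℝ} {f g : Euc d → ℝ≥0∞} (h : f ≤ᵐ[volume] g) :
    qerr p t f ≤ qerr p t g := by
  refine iInf₂_mono fun X _ => lintegral_mono_ae ?_
  filter_upwards [h] with y hy
  gcongr

theorem qerr_congr {t : ℝ} {f g : Euc d → ℝ≥0∞} (h : f =ᵐ[volume] g) :
    qerr p t f = qerr p t g :=
  le_antisymm (qerr_mono h.le) (qerr_mono h.symm.le)

theorem qmass_congr {f g : Euc d → ℝ≥0∞} (h : f =ᵐ[volume] g) : qmass p f = qmass p g := by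
  unfold qmass
  congr 1
  refine lintegral_congr_ae ?_
  filter_upwards [h] with y hy
  rw [hy]

theorem measurable_infEDist_rpow (X : Finset (Euc d)) :
    Measurable fun y => Metric.infEDist y (X : Set (Euc d)) ^ p :=
  Metric.continuous_infEDist.measurable.pow_const p

/-- The union of a configuration for `f` and one for `g` serves both densities at least as well. -/
theorem qerr_add_le (hp : 0 ≤ p) {s t : ℝ} {f g : Euc d → ℝ≥0∞} (hf : Measurable f) :
    qerr p (s + t) (f + g) ≤ qerr p s f + qerr p t g := by
  classical
  rw [qerr, qerr, qerr]
  simp_rw [ENNReal.iInf_add, ENNReal.add_iInf]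
  refine le_iInf₂ fun X hX => le_iInf₂ fun Y hY => ?_
  refine (iInf₂_le (X ∪ Y) ?_).trans ?_
  · have := Finset.card_union_le X Y
    have h : ((X ∪ Y).card : ℝ) ≤ X.card + Y.card := by exact_mod_cast this
    linarith
  · have hm : Measurable fun y => Metric.infEDist y (X : Set (Euc d)) ^ p * f y :=
      (measurable_infEDist_rpow X).mul hf
    rw [← lintegral_add_left hm]
    refine lintegral_mono fun y => ?_
    simp only [Pi.add_apply, mul_add, Finset.coe_union]
    gcongr
    · exact Set.subset_union_left
    · exact Set.subset_union_right

theorem qerr_zero {t : ℝ} (ht : 0 ≤ t) : qerr p t (0 : Euc d → ℝ≥0∞) = 0 := by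
  refine le_antisymm ((qerr_le _ ∅ (by simpa using ht)).trans ?_) bot_le
  simp

theorem qerr_sum_le (hp : 0 ≤ p) {ι : Type*} {t : ℝ} (s : Finset ι)
    {f : ι → Euc d → ℝ≥0∞} (hf : ∀ i, Measurable (f i)) :
    qerr p (s.card * t) (∑ i ∈ s, f i) ≤ ∑ i ∈ s, qerr p t (f i) := by
  classical
  induction s using Finset.induction_on with
  | empty => simp [qerr_zero]
  | insert a s ha ih =>
    rw [Finset.sum_insert ha, Finset.sum_insert ha, Finset.card_insert_of_notMem ha]
    have : ((s.card + 1 : ℕ) : ℝ) * t = t + s.card * t := by push_cast; ring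
    rw [this]
    exact (qerr_add_le hp (hf a)).trans (by gcongr)

theorem qerr_const_mul {t : ℝ} {c : ℝ≥0∞} (hc : c ≠ ∞) (hc0 : c ≠ 0) (f : Euc d → ℝ≥0∞) :
    qerr p t (fun y => c * f y) = c * qerr p t f := by
  unfold qerr
  rw [ENNReal.mul_iInf_of_ne hc0 hc]
  congr 1
  ext X
  rw [ENNReal.mul_iInf_of_ne hc0 hc]
  congr 1
  ext _
  rw [← lintegral_const_mul' _ _ hc]
  congr 1
  ext y
  ring

theorem qmass_const_mul (hd : 0 < d) (hp : 0 < p) {c : ℝ≥0∞} (hc : c ≠ ∞)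
    (f : Euc d → ℝ≥0∞) :
    qmass p (fun y => c * f y) = c * qmass p f := by
  have hd' : (0 : ℝ) < d := by exact_mod_cast hd
  unfold qmass
  have h1 : (0 : ℝ) ≤ d / (d + p) := by positivity
  simp_rw [ENNReal.mul_rpow_of_nonneg _ _ h1]
  rw [lintegral_const_mul' _ _ (ENNReal.rpow_ne_top_of_nonneg h1 hc),
    ENNReal.mul_rpow_of_nonneg _ _ (by positivity), ← ENNReal.rpow_mul]
  have : (d : ℝ) / (d + p) * ((d + p) / d) = 1 := by field_simp
  rw [this, ENNReal.rpow_one]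

/-- Change of variables under the similarity `y ↦ c + s • y`. -/
theorem lintegral_comp_similarity {s : ℝ} (hs : 0 < s) (c : Euc d) (F : Euc d → ℝ≥0∞) :
    ∫⁻ y, F (c + s • y) = ENNReal.ofReal (s ^ (-(d : ℝ))) * ∫⁻ z, F z := by
  have h1 : ∫⁻ y, F (c + s • y) = ∫⁻ y, F (c + y) ∂(Measure.map (fun x : Euc d => s • x) volume) :=
    (lintegral_map_equiv (fun y => F (c + y))
      (Homeomorph.smulOfNeZero s hs.ne').toMeasurableEquiv).symm
  rw [h1, Measure.map_addHaar_smul _ hs.ne', lintegral_smul_measure,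
    lintegral_add_left_eq_self (fun y => F y) c]
  congr 2
  rw [abs_of_pos (by positivity), Real.rpow_neg hs.le]
  simp

/-- Pulling a configuration for `F` back by the similarity divides distances by s, which contributes
s^(-p); the Jacobian contributes s^(-d). -/
theorem qerr_comp_similarity_le (hp : 0 < p) {t s : ℝ} (hs : 0 < s) (c : Euc d)
    (F : Euc d → ℝ≥0∞) :
    qerr p t (fun y => F (c + s • y)) ≤ ENNReal.ofReal (s ^ (-(d + p))) * qerr p t F := by
  classical
  have hs' : 0 < s ^ (-(d + p)) := Real.rpow_pos_of_pos hs _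
  conv_rhs => rw [qerr]
  rw [ENNReal.mul_iInf_of_ne (by simpa using hs') ENNReal.ofReal_ne_top]
  refine le_iInf fun X => ?_
  rw [ENNReal.mul_iInf_of_ne (by simpa using hs') ENNReal.ofReal_ne_top]
  refine le_iInf fun hX => ?_
  refine (qerr_le _ (X.image fun x => s⁻¹ • (x - c)) ?_).trans ?_
  · refine le_trans ?_ hX
    exact_mod_cast Finset.card_image_le
  have key : ∀ y : Euc d,
      Metric.infEDist y ((X.image fun x => s⁻¹ • (x - c) : Finset (Euc d)) : Set (Euc d)) ≤
        ENNReal.ofReal s⁻¹ * Metric.infEDist (c + s • y) X := by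
    intro y
    conv_rhs => rw [Metric.infEDist]
    rw [ENNReal.mul_iInf_of_ne (by simpa using hs) ENNReal.ofReal_ne_top]
    refine le_iInf fun x => ?_
    rw [ENNReal.mul_iInf_of_ne (by simpa using hs) ENNReal.ofReal_ne_top]
    refine le_iInf fun hx => ?_
    refine (Metric.infEDist_le_edist_of_mem (y := s⁻¹ • (x - c)) ?_).trans ?_
    · simp only [Finset.coe_image]
      exact Set.mem_image_of_mem _ hx
    · rw [edist_dist, edist_dist, ← ENNReal.ofReal_mul (by positivity)]
      apply ENNReal.ofReal_le_ofReal
      rw [dist_eq_norm, dist_eq_norm]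
      have : y - s⁻¹ • (x - c) = s⁻¹ • (c + s • y - x) := by
        rw [show c + s • y - x = s • y - (x - c) by abel, smul_sub s⁻¹ (s • y), smul_smul,
          inv_mul_cancel₀ hs.ne', one_smul]
      rw [this, norm_smul, Real.norm_of_nonneg (by positivity)]
  calc _ ≤ ∫⁻ y, ENNReal.ofReal s⁻¹ ^ p *
        (fun z => Metric.infEDist z (X : Set (Euc d)) ^ p * F z) (c + s • y) := by
        refine lintegral_mono fun y => ?_
        simp only
        rw [← mul_assoc, ← ENNReal.mul_rpow_of_nonneg _ _ hp.le]
        gcongr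
        exact key y
    _ = ENNReal.ofReal (s ^ (-(d + p))) * ∫⁻ z, Metric.infEDist z (X : Set (Euc d)) ^ p * F z := by
        rw [lintegral_const_mul' _ _ (ENNReal.rpow_ne_top_of_nonneg hp.le ENNReal.ofReal_ne_top),
          lintegral_comp_similarity hs c
            (fun z => Metric.infEDist z (X : Set (Euc d)) ^ p * F z), ← mul_assoc, ENNReal.ofReal_rpow_of_nonneg (by positivity)
          hp.le, ← ENNReal.ofReal_mul (by positivity)]
        congr 2
        rw [Real.inv_rpow hs.le, ← Real.rpow_neg hs.le, ← Real.rpow_add hs]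
        congr 1; ring
    _ ≤ _ := le_rfl

theorem qerr_comp_similarity (hp : 0 < p) {t s : ℝ} (hs : 0 < s) (c : Euc d)
    (F : Euc d → ℝ≥0∞) :
    qerr p t (fun y => F (c + s • y)) = ENNReal.ofReal (s ^ (-(d + p))) * qerr p t F := by
  refine le_antisymm (qerr_comp_similarity_le hp hs c F) ?_
  -- The reverse inequality is the same estimate for the inverse similarity.
  have h := qerr_comp_similarity_le hp (t := t) (inv_pos.2 hs) (-(s⁻¹ • c))
    (fun y => F (c + s • y))
  have h2 : (fun y => (fun y => F (c + s • y)) (-(s⁻¹ • c) + s⁻¹ • y)) = F := by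
    ext y
    simp [smul_smul, hs.ne']
  rw [h2] at h
  calc _ ≤ ENNReal.ofReal (s ^ (-(d + p))) * (ENNReal.ofReal (s⁻¹ ^ (-(d + p))) *
        qerr p t (fun y => F (c + s • y))) := by gcongr
    _ = _ := by
      rw [← mul_assoc, ← ENNReal.ofReal_mul (by positivity), Real.inv_rpow hs.le,
        mul_inv_cancel₀ (by positivity)]
      simp

theorem qmass_comp_similarity (hd : 0 < d) (hp : 0 < p) {s : ℝ} (hs : 0 < s) (c : Euc d)
    (F : Euc d → ℝ≥0∞) :
    qmass p (fun y => F (c + s • y)) = ENNReal.ofReal (s ^ (-(d + p))) * qmass p F := by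
  have hd' : (0 : ℝ) < d := by exact_mod_cast hd
  unfold qmass
  rw [lintegral_comp_similarity hs c (fun y => F y ^ ((d : ℝ) / (d + p))),
    ENNReal.mul_rpow_of_nonneg _ _ (by positivity),
    ENNReal.ofReal_rpow_of_nonneg (by positivity) (by positivity), ← Real.rpow_mul hs.le]
  congr 3
  field_simp

/-! ### Cubes, and Zador's formula for one cube -/

/-- The closed cube with centre `c` and half side `r`. -/
def cube (c : Euc d) (r : ℝ) : Set (Euc d) := {y | ∀ i, |y i - c i| ≤ r}

theorem isClosed_cube (c : Euc d) (r : ℝ) : IsClosed (cube c r) := by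
  unfold cube
  rw [Set.ofPred_forall]
  refine isClosed_iInter fun i => isClosed_le ?_ continuous_const
  fun_prop

theorem measurableSet_cube (c : Euc d) (r : ℝ) : MeasurableSet (cube c r) :=
  (isClosed_cube c r).measurableSet

theorem cube_subset_closedBall (c : Euc d) {r : ℝ} (hr : 0 ≤ r) :
    cube c r ⊆ Metric.closedBall c (√d * r) := by
  intro y hy
  rw [Metric.mem_closedBall, EuclideanSpace.dist_eq]
  calc _ ≤ √(∑ _i : Fin d, r ^ 2) := by
        apply Real.sqrt_le_sqrt
        refine Finset.sum_le_sum fun i _ => ?_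
        rw [Real.dist_eq]
        exact pow_le_pow_left₀ (abs_nonneg _) (hy i) 2
    _ = √d * r := by
        simp [Real.sqrt_sq hr]

theorem closedBall_subset_cube (c : Euc d) (r : ℝ) :
    Metric.closedBall c r ⊆ cube c r := by
  intro y hy i
  rw [Metric.mem_closedBall, dist_eq_norm] at hy
  have := PiLp.norm_apply_le (y - c) i
  simp only [PiLp.sub_apply, Real.norm_eq_abs] at this
  exact this.trans hy

theorem isCompact_cube (c : Euc d) {r : ℝ} (hr : 0 ≤ r) : IsCompact (cube c r) :=
  (isCompact_closedBall c (√d * r)).of_isClosed_subset (isClosed_cube c r)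
    (cube_subset_closedBall c hr)

/-- A cube is covered by `k ^ d` cubes of `k` times smaller side. -/
theorem exists_cube_cover {k : ℕ} (hk : 0 < k) {R : ℝ} (hR : 0 < R) :
    ∃ c : (Fin d → Fin k) → Euc d, cube 0 R ⊆ ⋃ i, cube (c i) (R / k) := by
  have hk' : (0 : ℝ) < k := by exact_mod_cast hk
  refine ⟨fun i => WithLp.toLp 2 fun j => R * (-1 + (2 * (i j : ℕ) + 1) / k), fun y hy => ?_⟩
  have h : ∀ j : Fin d, ∃ m : Fin k, |y j - R * (-1 + (2 * (m : ℕ) + 1) / k)| ≤ R / k := by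
    intro j
    have hyj : |y j| ≤ R := by simpa using hy j
    rw [abs_le] at hyj
    set u : ℝ := (y j / R + 1) * k / 2 with hu
    have hu0 : 0 ≤ u := by
      have : -1 ≤ y j / R := by rw [le_div_iff₀ hR]; linarith
      have : 0 ≤ y j / R + 1 := by linarith
      positivity
    have huk : u ≤ k := by
      have : y j / R ≤ 1 := by rw [div_le_one hR]; linarith
      rw [hu]; nlinarith
    have hyu : y j = R * (-1 + 2 * u / k) := by rw [hu]; field_simp; ring
    -- The index is the floor of u, except on the face u = k, which belongs to the last closed
    -- subinterval.
    have hm : ∃ m : ℕ, m < k ∧ (m : ℝ) ≤ u ∧ u ≤ m + 1 := by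
      by_cases h : ⌊u⌋₊ < k
      · exact ⟨⌊u⌋₊, h, Nat.floor_le hu0, (Nat.lt_floor_add_one u).le⟩
      · have h1 : (k : ℝ) ≤ u := (Nat.le_floor_iff hu0).1 (not_lt.1 h)
        refine ⟨k - 1, by omega, ?_, ?_⟩
        · rw [Nat.cast_sub hk]; push_cast; linarith
        · rw [Nat.cast_sub hk]; push_cast; linarith
    obtain ⟨m, hmk, h1, h2⟩ := hm
    refine ⟨⟨m, hmk⟩, ?_⟩
    have : y j - R * (-1 + (2 * (m : ℝ) + 1) / k) = R / k * (2 * (u - m) - 1) := by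
      rw [hyu]; field_simp; ring
    simp only
    rw [this, abs_mul, abs_of_pos (by positivity)]
    refine mul_le_of_le_one_right (by positivity) ?_
    rw [abs_le]; constructor <;> linarith
  choose m hm using h
  exact Set.mem_iUnion.2 ⟨m, fun j => by simpa using hm j⟩

/-- The indicator function of a cube. -/
def cubeInd (c : Euc d) (r : ℝ) : Euc d → ℝ≥0∞ := (cube c r).indicator 1

theorem measurable_cubeInd (c : Euc d) (r : ℝ) : Measurable (cubeInd c r) :=
  measurable_one.indicator (measurableSet_cube c r)

theorem cubeInd_comp (c : Euc d) {r : ℝ} (hr : 0 < r) :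
    (fun y => cubeInd c r (c + r • y)) = cubeInd 0 1 := by
  ext y
  unfold cubeInd
  have : c + r • y ∈ cube c r ↔ y ∈ cube 0 1 := by
    simp only [cube, Set.mem_ofPred_eq]
    refine forall_congr' fun i => ?_
    simp [abs_mul, abs_of_pos hr, hr]
  by_cases h : y ∈ cube 0 1
  · rw [Set.indicator_of_mem h, Set.indicator_of_mem (this.2 h)]; rfl
  · rw [Set.indicator_of_notMem h, Set.indicator_of_notMem (mt this.1 h)]

theorem ofReal_rpow_cancel {r : ℝ} (hr : 0 < r) (a : ℝ) (x : ℝ≥0∞) :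
    ENNReal.ofReal (r ^ a) * (ENNReal.ofReal (r ^ (-a)) * x) = x := by
  rw [← mul_assoc, ← ENNReal.ofReal_mul (by positivity), ← Real.rpow_add hr]
  simp

theorem qerr_cubeInd (hp : 0 < p) {t : ℝ} (c : Euc d) {r : ℝ} (hr : 0 < r) :
    qerr p t (cubeInd c r) = ENNReal.ofReal (r ^ (d + p)) * qerr p t (cubeInd (0 : Euc d) 1) := by
  rw [← cubeInd_comp c hr, qerr_comp_similarity hp hr c, ofReal_rpow_cancel hr]

theorem qmass_cubeInd (hd : 0 < d) (hp : 0 < p) (c : Euc d) {r : ℝ} (hr : 0 < r) :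
    qmass p (cubeInd c r) = ENNReal.ofReal (r ^ (d + p)) * qmass p (cubeInd (0 : Euc d) 1) := by
  rw [← cubeInd_comp c hr, qmass_comp_similarity hd hp hr c, ofReal_rpow_cancel hr]

/-- The rescaled error of a density on a cube is at most a constant times its total mass. -/
theorem sqerr_le_lintegral (hd : 0 < d) (hp : 0 < p) {R : ℝ} (hR : 0 < R) {h : Euc d → ℝ≥0∞}
    (hsupp : ∀ y ∉ cube (0 : Euc d) R, h y = 0) {t : ℝ} (ht : 1 ≤ t) :
    sqerr p t h ≤ ENNReal.ofReal ((2 * (√d * R)) ^ p) * ∫⁻ y, h y := by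
  classical
  have hd' : (0 : ℝ) < d := by exact_mod_cast hd
  -- With k = ⌊t^(1/d)⌋ the centres of k^d subcubes are at most t points; the factor 2 in the bound
  -- is t^(1/d) ≤ 2k, which needs t ≥ 1.
  set x : ℝ := t ^ (1 / (d : ℝ)) with hx
  have hx1 : 1 ≤ x := Real.one_le_rpow ht (by positivity)
  set k : ℕ := ⌊x⌋₊ with hk
  have hk1 : 1 ≤ k := (Nat.one_le_floor_iff x).2 hx1
  have hk1' : (1 : ℝ) ≤ k := by exact_mod_cast hk1
  have hkx : (k : ℝ) ≤ x := Nat.floor_le (by linarith)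
  have hxk : x ≤ 2 * k := by
    have := (Nat.lt_floor_add_one x).le
    rw [← hk] at this
    linarith
  have hkd : (k : ℝ) ^ d ≤ t := by
    calc (k : ℝ) ^ d ≤ x ^ d := by gcongr
      _ = t := by
        rw [hx, ← Real.rpow_natCast, ← Real.rpow_mul (by linarith)]
        field_simp
        exact Real.rpow_one t
  obtain ⟨c, hc⟩ := exists_cube_cover (d := d) hk1 hR
  have h1 : qerr p t h ≤ ENNReal.ofReal ((√d * (R / k)) ^ p) * ∫⁻ y, h y := by
    refine (qerr_le h (Finset.univ.image c) ?_).trans ?_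
    · refine le_trans ?_ hkd
      have : (Finset.univ.image c).card ≤ k ^ d := by
        refine Finset.card_image_le.trans ?_
        simp
      exact_mod_cast this
    · rw [← lintegral_const_mul' _ _ ENNReal.ofReal_ne_top]
      refine lintegral_mono fun y => ?_
      by_cases hy : y ∈ cube (0 : Euc d) R
      · simp only
        gcongr
        obtain ⟨i, hi⟩ := Set.mem_iUnion.1 (hc hy)
        rw [← ENNReal.ofReal_rpow_of_nonneg (by positivity) hp.le]
        gcongr
        refine (Metric.infEDist_le_edist_of_mem (y := c i) (by simp)).trans ?_
        rw [edist_dist]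
        exact ENNReal.ofReal_le_ofReal (cube_subset_closedBall (c i) (by positivity) hi)
      · simp [hsupp y hy]
  unfold sqerr
  calc _ ≤ ENNReal.ofReal (t ^ (p / d)) * (ENNReal.ofReal ((√d * (R / k)) ^ p) * ∫⁻ y, h y) := by
        gcongr
    _ ≤ _ := by
        rw [← mul_assoc, ← ENNReal.ofReal_mul (by positivity)]
        gcongr
        have : t ^ (p / d) = x ^ p := by
          rw [hx, ← Real.rpow_mul (by linarith)]
          congr 1; ring
        rw [this, ← Real.mul_rpow (by linarith) (by positivity)]
        apply Real.rpow_le_rpow (by positivity) _ hp.le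
        have h2 : x / k ≤ 2 := by rw [div_le_iff₀ (by linarith)]; linarith
        calc x * (√d * (R / k)) = (x / k) * (√d * R) := by ring
          _ ≤ 2 * (√d * R) := by gcongr

/-- Subdividing the cube compares the rescaled errors at different numbers of points. -/
theorem sqerr_cubeInd_le (hd : 0 < d) (hp : 0 < p) {m t : ℝ} (hm : 0 < m) (hmt : m ≤ t) :
    sqerr p t (cubeInd (0 : Euc d) 1) ≤
      ENNReal.ofReal (((t / m) ^ (1 / (d : ℝ)) / ⌊(t / m) ^ (1 / (d : ℝ))⌋₊) ^ p) *
        sqerr p m (cubeInd (0 : Euc d) 1) := by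
  have hd' : (0 : ℝ) < d := by exact_mod_cast hd
  have htm : 1 ≤ t / m := by rwa [one_le_div hm]
  have ht : 0 < t := by linarith
  -- The cube is cut into k^d subcubes with k = ⌊x⌋, and each receives m points, so k^d m ≤ t.
  -- Rounding x down to k is the only loss.
  set x : ℝ := (t / m) ^ (1 / (d : ℝ)) with hx
  have hx1 : 1 ≤ x := Real.one_le_rpow htm (by positivity)
  set k : ℕ := ⌊x⌋₊ with hk
  have hk1 : 1 ≤ k := (Nat.one_le_floor_iff x).2 hx1
  have hk1' : (1 : ℝ) ≤ k := by exact_mod_cast hk1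
  have hk0 : (0 : ℝ) < k := by linarith
  have hkx : (k : ℝ) ≤ x := Nat.floor_le (by linarith)
  have hkd : (k : ℝ) ^ d * m ≤ t := by
    calc (k : ℝ) ^ d * m ≤ x ^ d * m := by gcongr
      _ = t := by
        rw [hx, ← Real.rpow_natCast, ← Real.rpow_mul (by positivity)]
        rw [one_div_mul_cancel hd'.ne', Real.rpow_one]
        field_simp
  obtain ⟨c, hc⟩ := exists_cube_cover (d := d) hk1 one_pos
  have h1 : qerr p t (cubeInd (0 : Euc d) 1) ≤
      ENNReal.ofReal ((k : ℝ) ^ (-p)) * qerr p m (cubeInd (0 : Euc d) 1) := by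
    calc _ ≤ qerr p ((Finset.univ : Finset (Fin d → Fin k)).card * m) (cubeInd (0 : Euc d) 1) := by
          apply qerr_anti
          simpa using hkd
      _ ≤ qerr p ((Finset.univ : Finset (Fin d → Fin k)).card * m)
          (∑ i, cubeInd (c i) (1 / k)) := by
          apply qerr_mono
          refine Eventually.of_forall fun y => ?_
          by_cases hy : y ∈ cube (0 : Euc d) 1
          · obtain ⟨i, hi⟩ := Set.mem_iUnion.1 (hc hy)
            rw [cubeInd, Set.indicator_of_mem hy, Finset.sum_apply]
            refine le_trans ?_ (Finset.single_le_sum (fun j _ => zero_le) (Finset.mem_univ i))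
            rw [cubeInd, Set.indicator_of_mem hi]
          · rw [cubeInd, Set.indicator_of_notMem hy]
            exact zero_le
      _ ≤ ∑ i, qerr p m (cubeInd (c i) (1 / k)) :=
          qerr_sum_le hp.le _ fun i => measurable_cubeInd _ _
      _ = _ := by
          have hk2 : (0 : ℝ) < 1 / k := by positivity
          simp_rw [qerr_cubeInd hp _ hk2]
          rw [Finset.sum_const, nsmul_eq_mul, ← mul_assoc]
          congr 1
          have : ((Finset.univ : Finset (Fin d → Fin k)).card : ℝ≥0∞) =
              ENNReal.ofReal ((k : ℝ) ^ (d : ℝ)) := by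
            simp [ENNReal.ofReal_pow, hk0.le]
          rw [this, ← ENNReal.ofReal_mul (by positivity), one_div, Real.inv_rpow hk0.le,
            ← Real.rpow_neg hk0.le, ← Real.rpow_add hk0]
          congr 2; ring
  unfold sqerr
  calc _ ≤ ENNReal.ofReal (t ^ (p / d)) * (ENNReal.ofReal ((k : ℝ) ^ (-p)) *
        qerr p m (cubeInd (0 : Euc d) 1)) := by gcongr
    _ = _ := by
        rw [← mul_assoc, ← mul_assoc, ← ENNReal.ofReal_mul (by positivity),
          ← ENNReal.ofReal_mul (by positivity)]
        congr 2
        rw [Real.div_rpow (by linarith) hk0.le, hx, ← Real.rpow_mul (by positivity),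
          show 1 / (d : ℝ) * p = p / d by ring, Real.div_rpow ht.le hm.le, Real.rpow_neg hk0.le]
        have : m ^ (p / (d : ℝ)) ≠ 0 := by positivity
        field_simp

/-- The infimum of the rescaled errors of the standard cube. -/
def cubeConst (d : ℕ) (p : ℝ) : ℝ≥0∞ :=
  ⨅ (t : ℝ) (_ : 0 < t), sqerr p t (cubeInd (0 : Euc d) 1)

/-- A Fekete-type argument: the infimum is nearly attained at some m, and `sqerr_cubeInd_le` carries
that value to every large t with a factor (x/⌊x⌋)^p tending to 1. -/
theorem tendsto_sqerr_cubeInd_zero_one (hd : 0 < d) (hp : 0 < p) :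
    Tendsto (fun t => sqerr p t (cubeInd (0 : Euc d) 1)) atTop (𝓝 (cubeConst d p)) := by
  have hd' : (0 : ℝ) < d := by exact_mod_cast hd
  refine tendsto_order.2 ⟨fun v hv => ?_, fun v hv => ?_⟩
  · filter_upwards [eventually_gt_atTop 0] with t ht
    exact hv.trans_le (iInf₂_le t ht)
  · obtain ⟨m, hm⟩ := iInf_lt_iff.1 hv
    obtain ⟨hm0, hm⟩ := iInf_lt_iff.1 hm
    have h1 : Tendsto (fun t : ℝ => (t / m) ^ (1 / (d : ℝ))) atTop atTop :=
      (tendsto_rpow_atTop (by positivity)).comp (tendsto_id.atTop_div_const hm0)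
    have h2 : Tendsto (fun x : ℝ => (x / ⌊x⌋₊) ^ p) atTop (𝓝 1) := by
      have := (tendsto_nat_floor_div_atTop (R := ℝ)).inv₀ one_ne_zero
      have := this.rpow_const (p := p) (Or.inr hp.le)
      simpa using this
    have h3 := (ENNReal.tendsto_ofReal (h2.comp h1))
    have h4 := ENNReal.Tendsto.mul_const h3 (b := sqerr p m (cubeInd (0 : Euc d) 1))
      (Or.inr hm.ne_top)
    rw [ENNReal.ofReal_one, one_mul] at h4
    filter_upwards [h4.eventually_lt_const hm, eventually_ge_atTop m] with t ht htm
    exact (sqerr_cubeInd_le hd hp hm0 htm).trans_lt ht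

theorem volume_cube_pos (c : Euc d) {r : ℝ} (hr : 0 < r) : 0 < volume (cube c r) :=
  (Metric.measure_closedBall_pos volume c hr).trans_le
    (measure_mono (closedBall_subset_cube c r))

theorem volume_cube_ne_top (c : Euc d) {r : ℝ} (hr : 0 ≤ r) : volume (cube c r) ≠ ∞ :=
  (isCompact_cube c hr).measure_lt_top.ne

theorem lintegral_cubeInd_rpow (c : Euc d) (r : ℝ) {a : ℝ} (ha : 0 < a) :
    ∫⁻ y, cubeInd c r y ^ a = volume (cube c r) := by
  have : (fun y => cubeInd c r y ^ a) = (cube c r).indicator 1 := by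
    ext y
    unfold cubeInd
    by_cases h : y ∈ cube c r
    · simp [Set.indicator_of_mem h]
    · simp [Set.indicator_of_notMem h, ha]
  rw [this, lintegral_indicator_one (measurableSet_cube c r)]

theorem cubeConst_ne_top (hd : 0 < d) (hp : 0 < p) : cubeConst d p ≠ ∞ := by
  refine ne_top_of_le_ne_top ?_ (iInf₂_le (1 : ℝ) one_pos)
  refine ne_top_of_le_ne_top ?_ (sqerr_le_lintegral hd hp one_pos (fun y hy => ?_) le_rfl)
  · refine ENNReal.mul_ne_top ENNReal.ofReal_ne_top ?_
    have := lintegral_cubeInd_rpow (0 : Euc d) 1 one_pos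
    simp only [ENNReal.rpow_one] at this
    rw [this]
    exact volume_cube_ne_top _ zero_le_one
  · exact Set.indicator_of_notMem hy _

/-- Volume count: t balls of radius r of order t^(-1/d) cover at most half of the cube, and the
other half is at distance at least r from every point. -/
theorem cubeConst_ne_zero (hd : 0 < d) (hp : 0 < p) : cubeConst d p ≠ 0 := by
  have hd' : (0 : ℝ) < d := by exact_mod_cast hd
  have : Nonempty (Fin d) := ⟨⟨0, hd⟩⟩
  set v : ℝ := (volume (cube (0 : Euc d) 1)).toReal with hv
  set w : ℝ := (volume (Metric.ball (0 : Euc d) 1)).toReal with hw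
  have hv0 : 0 < v := ENNReal.toReal_pos (volume_cube_pos _ one_pos).ne'
    (volume_cube_ne_top _ zero_le_one)
  have hw0 : 0 < w := ENNReal.toReal_pos (Metric.measure_ball_pos volume _ one_pos).ne'
    measure_ball_lt_top.ne
  have hvE : volume (cube (0 : Euc d) 1) = ENNReal.ofReal v :=
    (ENNReal.ofReal_toReal (volume_cube_ne_top _ zero_le_one)).symm
  have hwE : volume (Metric.ball (0 : Euc d) 1) = ENNReal.ofReal w :=
    (ENNReal.ofReal_toReal measure_ball_lt_top.ne).symm
  have key : ENNReal.ofReal ((v / (2 * w)) ^ (p / d) * (v / 2)) ≤ cubeConst d p := by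
    refine le_iInf₂ fun t ht => ?_
    -- Chosen so that t balls of radius r have total volume v/2, half that of the cube.
    set r : ℝ := (v / (2 * t * w)) ^ (1 / (d : ℝ)) with hr
    have hr0 : 0 < r := by positivity
    have hrd : r ^ d = v / (2 * t * w) := by
      rw [hr, ← Real.rpow_natCast, ← Real.rpow_mul (by positivity), one_div_mul_cancel hd'.ne',
        Real.rpow_one]
    have h1 : ENNReal.ofReal (r ^ p * (v / 2)) ≤ qerr p t (cubeInd (0 : Euc d) 1) := by
      refine le_iInf₂ fun X hX => ?_
      set B : Set (Euc d) := ⋃ x ∈ X, Metric.ball x r with hB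
      have hBv : volume B ≤ ENNReal.ofReal (v / 2) := by
        calc volume B ≤ ∑ x ∈ X, volume (Metric.ball x r) := measure_biUnion_finset_le _ _
          _ = X.card * (ENNReal.ofReal (r ^ d) * ENNReal.ofReal w) := by
            have hb : ∀ x : Euc d, volume (Metric.ball x r) =
                ENNReal.ofReal (r ^ d) * ENNReal.ofReal w := fun x => by
              rw [Measure.addHaar_ball volume x hr0.le, hwE, finrank_euclideanSpace_fin]
            rw [Finset.sum_congr rfl fun x _ => hb x, Finset.sum_const, nsmul_eq_mul]
          _ = ENNReal.ofReal (X.card * (r ^ d * w)) := by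
            rw [ENNReal.ofReal_mul (Nat.cast_nonneg _), ENNReal.ofReal_mul (by positivity),
              ENNReal.ofReal_natCast]
          _ ≤ _ := by
            apply ENNReal.ofReal_le_ofReal
            calc X.card * (r ^ d * w) ≤ t * (r ^ d * w) := by gcongr
              _ = v / 2 := by rw [hrd]; field_simp
      have hBm : MeasurableSet B := X.measurableSet_biUnion fun x _ => Metric.isOpen_ball.measurableSet
      have hdiff : ENNReal.ofReal (v / 2) ≤ volume (cube (0 : Euc d) 1 \ B) := by
        have := le_measure_sdiff (μ := volume) (s₁ := cube (0 : Euc d) 1) (s₂ := B)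
        refine le_trans ?_ this
        rw [hvE]
        refine le_trans ?_ (tsub_le_tsub_left hBv _)
        rw [← ENNReal.ofReal_sub _ (by positivity)]
        apply ENNReal.ofReal_le_ofReal; linarith
      calc ENNReal.ofReal (r ^ p * (v / 2))
          ≤ ENNReal.ofReal (r ^ p) * volume (cube (0 : Euc d) 1 \ B) := by
            rw [ENNReal.ofReal_mul (by positivity)]; gcongr
        _ = ∫⁻ y, (cube (0 : Euc d) 1 \ B).indicator (fun _ => ENNReal.ofReal (r ^ p)) y := by
            rw [lintegral_indicator_const ((measurableSet_cube _ _).diff hBm)]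
        _ ≤ _ := by
            refine lintegral_mono fun y => ?_
            by_cases hy : y ∈ cube (0 : Euc d) 1 \ B
            swap
            · rw [Set.indicator_of_notMem hy]
              exact zero_le
            rw [Set.indicator_of_mem hy]
            rw [cubeInd, Set.indicator_of_mem hy.1, Pi.one_apply, mul_one,
              ← ENNReal.ofReal_rpow_of_nonneg hr0.le hp.le]
            gcongr
            rw [Metric.le_infEDist]
            intro x hx
            rw [edist_dist]
            apply ENNReal.ofReal_le_ofReal
            by_contra hlt
            exact hy.2 (Set.mem_biUnion hx (Metric.mem_ball.2 (not_le.1 hlt)))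
    unfold sqerr
    refine le_trans (le_of_eq ?_) (mul_le_mul_right h1 _)
    rw [← ENNReal.ofReal_mul (by positivity)]
    congr 1
    rw [hr, ← Real.rpow_mul (by positivity), ← mul_assoc, show 1 / (d : ℝ) * p = p / d by ring,
      ← Real.mul_rpow ht.le (by positivity)]
    congr 2
    field_simp
  intro h
  rw [h, nonpos_iff_eq_zero, ENNReal.ofReal_eq_zero] at key
  have : 0 < (v / (2 * w)) ^ (p / d) * (v / 2) := by positivity
  linarith

/-- Zador's constant. -/
def zadorConst (d : ℕ) (p : ℝ) : ℝ≥0∞ := cubeConst d p / qmass p (cubeInd (0 : Euc d) 1)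

theorem qmass_cubeInd_zero_one_ne_zero (hd : 0 < d) (hp : 0 < p) :
    qmass p (cubeInd (0 : Euc d) 1) ≠ 0 := by
  have hd' : (0 : ℝ) < d := by exact_mod_cast hd
  unfold qmass
  rw [lintegral_cubeInd_rpow _ _ (by positivity)]
  exact (ENNReal.rpow_pos (volume_cube_pos _ one_pos) (volume_cube_ne_top _ zero_le_one)).ne'

theorem qmass_cubeInd_zero_one_ne_top (hd : 0 < d) (hp : 0 < p) :
    qmass p (cubeInd (0 : Euc d) 1) ≠ ∞ := by
  have hd' : (0 : ℝ) < d := by exact_mod_cast hd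
  unfold qmass
  rw [lintegral_cubeInd_rpow _ _ (by positivity)]
  exact ENNReal.rpow_ne_top_of_nonneg (by positivity) (volume_cube_ne_top _ zero_le_one)

theorem zadorConst_ne_zero (hd : 0 < d) (hp : 0 < p) : zadorConst d p ≠ 0 :=
  ENNReal.div_ne_zero.2 ⟨cubeConst_ne_zero hd hp, qmass_cubeInd_zero_one_ne_top hd hp⟩

theorem zadorConst_ne_top (hd : 0 < d) (hp : 0 < p) : zadorConst d p ≠ ∞ :=
  ENNReal.div_ne_top (cubeConst_ne_top hd hp) (qmass_cubeInd_zero_one_ne_zero hd hp)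

/-! ### Zador's formula and its stability in L¹ -/

/-- Zador's asymptotic formula for the density `f`. -/
def IsZador (p : ℝ) (f : Euc d → ℝ≥0∞) : Prop :=
  Tendsto (fun t => sqerr p t f) atTop (𝓝 (zadorConst d p * qmass p f))

theorem IsZador.congr {f g : Euc d → ℝ≥0∞} (hf : IsZador p f) (h : f =ᵐ[volume] g) :
    IsZador p g := by
  unfold IsZador sqerr at *
  simpa only [qerr_congr h, qmass_congr h] using hf

theorem isZador_cubeInd (hd : 0 < d) (hp : 0 < p) (c : Euc d) {r : ℝ} (hr : 0 < r) :
    IsZador p (cubeInd c r) := by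
  unfold IsZador
  have h := ENNReal.Tendsto.const_mul (a := ENNReal.ofReal (r ^ (d + p)))
    (tendsto_sqerr_cubeInd_zero_one hd hp) (Or.inr ENNReal.ofReal_ne_top)
  refine (h.congr fun t => ?_).trans (le_of_eq ?_)
  · unfold sqerr
    rw [qerr_cubeInd hp c hr]; ring
  · rw [qmass_cubeInd hd hp c hr, mul_left_comm, zadorConst,
      ENNReal.div_mul_cancel (qmass_cubeInd_zero_one_ne_zero hd hp)
        (qmass_cubeInd_zero_one_ne_top hd hp)]

theorem isZador_zero (hd : 0 < d) (hp : 0 < p) : IsZador p (0 : Euc d → ℝ≥0∞) := by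
  have hd' : (0 : ℝ) < d := by exact_mod_cast hd
  have h1 : 0 < (d : ℝ) / (d + p) := by positivity
  have h2 : 0 < ((d : ℝ) + p) / d := by positivity
  have h : qmass p (0 : Euc d → ℝ≥0∞) = 0 := by simp [qmass, h1, h2]
  unfold IsZador
  rw [h, mul_zero]
  refine tendsto_const_nhds.congr' ?_
  filter_upwards [eventually_ge_atTop 0] with t ht
  rw [sqerr, qerr_zero ht, mul_zero]

theorem IsZador.const_mul (hd : 0 < d) (hp : 0 < p) {f : Euc d → ℝ≥0∞} (hf : IsZador p f)
    {c : ℝ≥0∞} (hc : c ≠ ∞) : IsZador p (fun y => c * f y) := by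
  rcases eq_or_ne c 0 with rfl | hc0
  · simp only [zero_mul]
    exact isZador_zero hd hp
  · unfold IsZador
    have h := ENNReal.Tendsto.const_mul (a := c) hf (Or.inr hc)
    refine (h.congr fun t => ?_).trans (le_of_eq ?_)
    · unfold sqerr
      rw [qerr_const_mul hc hc0]; ring
    · rw [qmass_const_mul hd hp hc, mul_left_comm]

/-- A fraction θ of the points is given to `f` and the rest to `g`; the prefactors come from
rescaling by θt and (1-θ)t instead of t. -/
theorem sqerr_add_le (hp : 0 ≤ p) {θ t : ℝ} (hθ0 : 0 < θ) (hθ1 : θ < 1) (ht : 0 ≤ t)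
    {f g : Euc d → ℝ≥0∞} (hf : Measurable f) :
    sqerr p t (f + g) ≤ ENNReal.ofReal (θ ^ (-(p / d))) * sqerr p (θ * t) f +
      ENNReal.ofReal ((1 - θ) ^ (-(p / d))) * sqerr p ((1 - θ) * t) g := by
  have key : ∀ a : ℝ, 0 < a → ∀ u : Euc d → ℝ≥0∞,
      ENNReal.ofReal (a ^ (-(p / d))) * sqerr p (a * t) u =
        ENNReal.ofReal (t ^ (p / d)) * qerr p (a * t) u := by
    intro a ha u
    rw [sqerr, ← mul_assoc, ← ENNReal.ofReal_mul (by positivity), Real.mul_rpow ha.le ht,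
      ← mul_assoc, ← Real.rpow_add ha]
    simp
  rw [key θ hθ0, key (1 - θ) (by linarith), ← mul_add, sqerr]
  gcongr
  have : t = θ * t + (1 - θ) * t := by ring
  conv_lhs => rw [this]
  exact qerr_add_le hp hf

theorem exponent_pos (hd : 0 < d) (hp : 0 < p) : 0 < (d : ℝ) / (d + p) := by
  have hd' : (0 : ℝ) < d := by exact_mod_cast hd
  positivity

theorem exponent_lt_one (hd : 0 < d) (hp : 0 < p) : (d : ℝ) / (d + p) < 1 := by
  have hd' : (0 : ℝ) < d := by exact_mod_cast hd
  rw [div_lt_one (by positivity)]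
  linarith

theorem lintegral_rpow_add_le {a : ℝ} (ha0 : 0 ≤ a) (ha1 : a ≤ 1) {f g h : Euc d → ℝ≥0∞}
    (hh : Measurable h) (hle : f ≤ g + h) :
    ∫⁻ y, f y ^ a ≤ (∫⁻ y, g y ^ a) + ∫⁻ y, h y ^ a := by
  rw [← lintegral_add_right _ (hh.pow_const a)]
  refine lintegral_mono fun y => ?_
  calc f y ^ a ≤ (g y + h y) ^ a := by gcongr; exact hle y
    _ ≤ _ := ENNReal.rpow_add_le_add_rpow _ _ ha0 ha1

/-- Hölder's inequality against the indicator of the cube, with exponents 1/a and 1/(1-a). On a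
bounded domain, L¹ smallness therefore controls the integral entering `qmass`. -/
theorem lintegral_rpow_le_of_support {a : ℝ} (ha0 : 0 < a) (ha1 : a < 1) {R : ℝ}
    {h : Euc d → ℝ≥0∞} (hh : Measurable h) (hsupp : ∀ y ∉ cube (0 : Euc d) R, h y = 0) :
    ∫⁻ y, h y ^ a ≤ (∫⁻ y, h y) ^ a * volume (cube (0 : Euc d) R) ^ (1 - a) := by
  have hconj : (1 / a).HolderConjugate (1 / (1 - a)) := by
    rw [Real.holderConjugate_iff]
    refine ⟨by rw [lt_div_iff₀ ha0]; linarith, ?_⟩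
    simp
  have h1 := ENNReal.lintegral_mul_le_Lp_mul_Lq volume hconj (hh.pow_const a).aemeasurable
    (measurable_cubeInd (0 : Euc d) R).aemeasurable
  have ha2 : 0 < 1 - a := by linarith
  simp_rw [← ENNReal.rpow_mul] at h1
  rw [mul_one_div_cancel ha0.ne', one_div_one_div, one_div_one_div,
    lintegral_cubeInd_rpow _ _ (by positivity)] at h1
  simp only [ENNReal.rpow_one] at h1
  refine le_trans (le_of_eq ?_) h1
  congr 1
  ext y
  simp only [Pi.mul_apply, cubeInd]
  by_cases hy : y ∈ cube (0 : Euc d) R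
  · simp [Set.indicator_of_mem hy]
  · simp [hsupp y hy, ha0]

theorem tendsto_ofReal_rpow_mul_one (a : ℝ) {M : ℝ≥0∞} :
    Tendsto (fun θ : ℝ => ENNReal.ofReal (θ ^ a) * M) (𝓝[<] 1) (𝓝 M) := by
  have h1 : Tendsto (fun θ : ℝ => θ ^ a) (𝓝[<] 1) (𝓝 1) := by
    have : ContinuousAt (fun θ : ℝ => θ ^ a) 1 :=
      Real.continuousAt_rpow_const _ _ (Or.inl one_ne_zero)
    simpa using this.tendsto.mono_left nhdsWithin_le_nhds
  have h2 := ENNReal.Tendsto.mul_const (ENNReal.tendsto_ofReal h1) (b := M) (Or.inl (by simp))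
  simpa using h2

/-- Zador's formula passes to limits in `L¹` on a bounded domain. -/
theorem isZador_of_tendsto (hd : 0 < d) (hp : 0 < p) {R : ℝ} (hR : 0 < R)
    {f : Euc d → ℝ≥0∞} {g h : ℕ → Euc d → ℝ≥0∞} (hf : Measurable f)
    (hg : ∀ k, Measurable (g k)) (hh : ∀ k, Measurable (h k))
    (hsupp : ∀ k, ∀ y ∉ cube (0 : Euc d) R, h k y = 0)
    (hfg : ∀ k, f ≤ g k + h k) (hgf : ∀ k, g k ≤ f + h k)
    (hlim : Tendsto (fun k => ∫⁻ y, h k y) atTop (𝓝 0))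
    (hfin : ∫⁻ y, f y ^ ((d : ℝ) / (d + p)) ≠ ∞)
    (hZ : ∀ k, IsZador p (g k)) : IsZador p f := by
  have hd' : (0 : ℝ) < d := by exact_mod_cast hd
  set q : ℝ := (d : ℝ) / (d + p) with hq
  have hq0 : 0 < q := exponent_pos hd hp
  have hq1 : q < 1 := exponent_lt_one hd hp
  have hSh : Tendsto (fun k => ∫⁻ y, h k y ^ q) atTop (𝓝 0) := by
    have h1 : Tendsto (fun k => (∫⁻ y, h k y) ^ q * volume (cube (0 : Euc d) R) ^ (1 - q))
        atTop (𝓝 0) := by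
      have h2 := ENNReal.Tendsto.mul_const (hlim.ennrpow_const q)
        (b := volume (cube (0 : Euc d) R) ^ (1 - q))
        (Or.inr (ENNReal.rpow_ne_top_of_nonneg (by linarith) (volume_cube_ne_top _ hR.le)))
      simpa [hq0] using h2
    exact tendsto_of_tendsto_of_tendsto_of_le_of_le tendsto_const_nhds h1 (fun _ => zero_le)
      fun k => lintegral_rpow_le_of_support hq0 hq1 (hh k) (hsupp k)
  have hSg : Tendsto (fun k => ∫⁻ y, g k y ^ q) atTop (𝓝 (∫⁻ y, f y ^ q)) := by
    refine tendsto_of_tendsto_of_tendsto_of_le_of_le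
      (g := fun k => (∫⁻ y, f y ^ q) - ∫⁻ y, h k y ^ q)
      (h := fun k => (∫⁻ y, f y ^ q) + ∫⁻ y, h k y ^ q) ?_ ?_ (fun k => ?_) (fun k => ?_)
    · have := ENNReal.Tendsto.sub (tendsto_const_nhds (x := ∫⁻ y, f y ^ q)) hSh
        (Or.inl hfin)
      simpa using this
    · have := (tendsto_const_nhds (x := ∫⁻ y, f y ^ q)).add hSh
      simpa using this
    · exact tsub_le_iff_right.2 (lintegral_rpow_add_le hq0.le hq1.le (hh k) (hfg k))
    · exact lintegral_rpow_add_le hq0.le hq1.le (hh k) (hgf k)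
  set M : ℝ≥0∞ := zadorConst d p * qmass p f with hM
  have hMg : Tendsto (fun k => zadorConst d p * qmass p (g k)) atTop (𝓝 M) :=
    ENNReal.Tendsto.const_mul (hSg.ennrpow_const _) (Or.inr (zadorConst_ne_top hd hp))
  set c : ℝ≥0∞ := ENNReal.ofReal ((2 * (√d * R)) ^ p) with hc
  have herr : ∀ θ : ℝ, Tendsto (fun k => ENNReal.ofReal ((1 - θ) ^ (-(p / d))) *
      (c * ∫⁻ y, h k y)) atTop (𝓝 0) := by
    intro θ
    have h1 := ENNReal.Tendsto.const_mul (a := c) hlim (Or.inr ENNReal.ofReal_ne_top)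
    have h2 := ENNReal.Tendsto.const_mul (a := ENNReal.ofReal ((1 - θ) ^ (-(p / d)))) h1
      (Or.inr ENNReal.ofReal_ne_top)
    simpa using h2
  have hmono : ∀ {u w : Euc d → ℝ≥0∞} (t : ℝ), u ≤ w → sqerr p t u ≤ sqerr p t w := by
    intro u w t huw
    unfold sqerr
    gcongr
    exact qerr_mono (Eventually.of_forall huw)
  have hbound : ∀ {u w : Euc d → ℝ≥0∞} (θ t : ℝ) (k : ℕ), 0 < θ → θ < 1 → 1 ≤ (1 - θ) * t →
      Measurable w → u ≤ w + h k →
      sqerr p t u ≤ ENNReal.ofReal (θ ^ (-(p / d))) * sqerr p (θ * t) w +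
        ENNReal.ofReal ((1 - θ) ^ (-(p / d))) * (c * ∫⁻ y, h k y) := by
    intro u w θ t k hθ0 hθ1 ht hw huw
    have ht0 : 0 ≤ t := by
      by_contra hlt
      nlinarith [not_le.1 hlt]
    refine (hmono t huw).trans ((sqerr_add_le hp.le hθ0 hθ1 ht0 hw).trans ?_)
    gcongr
    exact sqerr_le_lintegral hd hp hR (hsupp k) ht
  have hθev : ∀ᶠ θ : ℝ in 𝓝[<] 1, 0 < θ ∧ θ < 1 := by
    filter_upwards [self_mem_nhdsWithin, nhdsWithin_le_nhds (lt_mem_nhds one_pos)] with θ h1 h2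
    exact ⟨h2, h1⟩
  refine tendsto_order.2 ⟨fun v hv => ?_, fun v hv => ?_⟩
  -- θ is fixed before k: θ close to 1 makes the main factor θ^(-p/d) harmless, but the factor
  -- (1-θ)^(-p/d) of the error term is then large and must be beaten by k.
  · obtain ⟨θ, hθ, hθ0, hθ1⟩ := (((tendsto_ofReal_rpow_mul_one (-(p / d)) (M := v)
      ).eventually_lt_const hv).and hθev).exists
    have h1 : Tendsto (fun k => ENNReal.ofReal (θ ^ (-(p / d))) * v +
        ENNReal.ofReal ((1 - θ) ^ (-(p / d))) * (c * ∫⁻ y, h k y)) atTop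
        (𝓝 (ENNReal.ofReal (θ ^ (-(p / d))) * v)) := by
      simpa using (tendsto_const_nhds (x := ENNReal.ofReal (θ ^ (-(p / d))) * v)).add (herr θ)
    obtain ⟨k, hk⟩ := (h1.eventually_lt hMg hθ).exists
    -- In the lower bound g k ≤ f + h k is used with t/θ points in all, so that exactly t are left
    -- for f.
    have h2 : Tendsto (fun t : ℝ => sqerr p (t / θ) (g k)) atTop
        (𝓝 (zadorConst d p * qmass p (g k))) :=
      (hZ k).comp (tendsto_id.atTop_div_const hθ0)
    filter_upwards [h2.eventually_const_lt hk,
      (tendsto_id.atTop_div_const hθ0).eventually_ge_atTop (1 / (1 - θ))] with t ht1 ht2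
    by_contra hle
    have h3 := hbound θ (t / θ) k hθ0 hθ1
      (by rw [div_le_iff₀ (by linarith)] at ht2; simpa [mul_comm] using ht2) hf (hgf k)
    rw [mul_div_cancel₀ _ hθ0.ne'] at h3
    refine absurd (ht1.trans_le h3) (not_lt.2 ?_)
    gcongr
    exact not_lt.1 hle
  · obtain ⟨θ, hθ, hθ0, hθ1⟩ := (((tendsto_ofReal_rpow_mul_one (-(p / d)) (M := M)
      ).eventually_lt_const hv).and hθev).exists
    have h1 : Tendsto (fun k => ENNReal.ofReal (θ ^ (-(p / d))) * (zadorConst d p * qmass p (g k)) +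
        ENNReal.ofReal ((1 - θ) ^ (-(p / d))) * (c * ∫⁻ y, h k y)) atTop
        (𝓝 (ENNReal.ofReal (θ ^ (-(p / d))) * M)) := by
      simpa using (ENNReal.Tendsto.const_mul (a := ENNReal.ofReal (θ ^ (-(p / d)))) hMg
        (Or.inr ENNReal.ofReal_ne_top)).add (herr θ)
    obtain ⟨k, hk⟩ := (h1.eventually_lt_const hθ).exists
    have h2 : Tendsto (fun t : ℝ => ENNReal.ofReal (θ ^ (-(p / d))) * sqerr p (θ * t) (g k) +
        ENNReal.ofReal ((1 - θ) ^ (-(p / d))) * (c * ∫⁻ y, h k y)) atTop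
        (𝓝 (ENNReal.ofReal (θ ^ (-(p / d))) * (zadorConst d p * qmass p (g k)) +
        ENNReal.ofReal ((1 - θ) ^ (-(p / d))) * (c * ∫⁻ y, h k y))) :=
      (ENNReal.Tendsto.const_mul ((hZ k).comp (tendsto_id.const_mul_atTop hθ0))
        (Or.inr ENNReal.ofReal_ne_top)).add_const _
    filter_upwards [h2.eventually_lt_const hk,
      (tendsto_id.const_mul_atTop (show 0 < 1 - θ by linarith)).eventually_ge_atTop 1]
      with t ht1 ht2
    exact (hbound θ t k hθ0 hθ1 ht2 (hg k) (hfg k)).trans_lt ht1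

/-- A density that can be approximated in `L¹` by densities satisfying Zador's formula satisfies
it as well. -/
theorem isZador_of_forall_approx (hd : 0 < d) (hp : 0 < p) {R : ℝ} (hR : 0 < R)
    {f : Euc d → ℝ≥0∞} (hf : Measurable f) (hfsupp : ∀ y ∉ cube (0 : Euc d) R, f y = 0)
    (hfin : ∫⁻ y, f y ≠ ∞)
    (H : ∀ ε : ℝ≥0∞, 0 < ε → ∃ g h : Euc d → ℝ≥0∞, Measurable g ∧ Measurable h ∧
      (∀ y ∉ cube (0 : Euc d) R, h y = 0) ∧ f ≤ g + h ∧ g ≤ f + h ∧ ∫⁻ y, h y ≤ ε ∧ IsZador p g) :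
    IsZador p f := by
  have hpos : ∀ k : ℕ, (0 : ℝ≥0∞) < ((k : ℝ≥0∞) + 1)⁻¹ := fun k => by simp
  choose g h hg hh hsupp hfg hgf hle hZ using fun k : ℕ => H _ (hpos k)
  refine isZador_of_tendsto hd hp hR hf hg hh hsupp hfg hgf ?_ ?_ hZ
  · refine tendsto_of_tendsto_of_tendsto_of_le_of_le tendsto_const_nhds ?_ (fun _ => zero_le) hle
    have := ENNReal.tendsto_inv_nat_nhds_zero.comp (tendsto_add_atTop_nat 1)
    refine this.congr fun k => by simp
  · refine ne_top_of_le_ne_top ?_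
      (lintegral_rpow_le_of_support (exponent_pos hd hp) (exponent_lt_one hd hp) hf hfsupp)
    have := exponent_lt_one hd hp
    exact ENNReal.mul_ne_top (ENNReal.rpow_ne_top_of_nonneg (exponent_pos hd hp).le hfin)
      (ENNReal.rpow_ne_top_of_nonneg (by linarith) (volume_cube_ne_top _ hR.le))

/-! ### Convexity, and additivity over disjoint supports -/

/-- The tangent line inequality for `a ↦ a ^ (1 + α)`, in homogeneous form. -/
theorem tangent_le {α a x l : ℝ} (hα : 0 < α) (ha : 0 ≤ a) (hx : 0 < x) (hl : 0 < l) :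
    (1 + α) * (a * l ^ α) - α * (x * l ^ (1 + α)) ≤ a ^ (1 + α) * x ^ (-α) := by
  -- Bernoulli's inequality at the ratio a/(xl), to be multiplied by x l^(1+α).
  have h := one_add_mul_self_le_rpow_one_add (s := a / (x * l) - 1) (p := 1 + α)
    (by have : 0 ≤ a / (x * l) := by positivity
        linarith) (by linarith)
  rw [show 1 + (a / (x * l) - 1) = a / (x * l) by ring, Real.div_rpow ha (by positivity),
    Real.mul_rpow hx.le hl.le] at h
  have h2 := mul_le_mul_of_nonneg_left h (show 0 ≤ x * l ^ (1 + α) by positivity)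
  have h3 : x * l ^ (1 + α) * (a ^ (1 + α) / (x ^ (1 + α) * l ^ (1 + α))) =
      a ^ (1 + α) * x ^ (-α) := by
    have : x ^ (1 + α) = x * x ^ α := by rw [Real.rpow_add hx, Real.rpow_one]
    rw [this, Real.rpow_neg hx.le]
    field_simp
  rw [h3] at h2
  refine le_trans (le_of_eq ?_) h2
  have : l ^ (1 + α) = l * l ^ α := by rw [Real.rpow_add hl, Real.rpow_one]
  rw [this]
  field_simp
  ring

/-- Strict Bernoulli: the tangent line touches only at a = xl. This strictness is what later pins
down the share of points. -/
theorem tangent_lt {α a x l : ℝ} (hα : 0 < α) (ha : 0 ≤ a) (hx : 0 < x) (hl : 0 < l)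
    (hne : a ≠ x * l) :
    (1 + α) * (a * l ^ α) - α * (x * l ^ (1 + α)) < a ^ (1 + α) * x ^ (-α) := by
  have h := one_add_mul_self_lt_rpow_one_add (s := a / (x * l) - 1) (p := 1 + α)
    (by have : 0 ≤ a / (x * l) := by positivity
        linarith)
    (by rw [sub_ne_zero, Ne, div_eq_one_iff_eq (by positivity)]; exact hne) (by linarith)
  rw [show 1 + (a / (x * l) - 1) = a / (x * l) by ring, Real.div_rpow ha (by positivity),
    Real.mul_rpow hx.le hl.le] at h
  have h2 := mul_lt_mul_of_pos_left h (show 0 < x * l ^ (1 + α) by positivity)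
  have h3 : x * l ^ (1 + α) * (a ^ (1 + α) / (x ^ (1 + α) * l ^ (1 + α))) =
      a ^ (1 + α) * x ^ (-α) := by
    have : x ^ (1 + α) = x * x ^ α := by rw [Real.rpow_add hx, Real.rpow_one]
    rw [this, Real.rpow_neg hx.le]
    field_simp
  rw [h3] at h2
  refine lt_of_eq_of_lt ?_ h2
  have : l ^ (1 + α) = l * l ^ α := by rw [Real.rpow_add hl, Real.rpow_one]
  rw [this]
  field_simp
  ring

/-- Two tangent inequalities at the common ratio l = (a+b)/(x+y), whose left sides add up exactly.
It says that no division of the points between two masses beats the proportional one. -/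
theorem rpow_add_mul_rpow_neg_le {α a b x y : ℝ} (hα : 0 < α) (ha : 0 ≤ a) (hb : 0 ≤ b)
    (hx : 0 < x) (hy : 0 < y) :
    (a + b) ^ (1 + α) * (x + y) ^ (-α) ≤ a ^ (1 + α) * x ^ (-α) + b ^ (1 + α) * y ^ (-α) := by
  rcases (add_nonneg ha hb).eq_or_lt with h0 | h0
  · rw [← h0, Real.zero_rpow (by linarith), zero_mul]
    positivity
  · have hl : 0 < (a + b) / (x + y) := by positivity
    refine le_trans (le_of_eq ?_) (add_le_add (tangent_le hα ha hx hl) (tangent_le hα hb hy hl))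
    have hxy : 0 < x + y := by positivity
    have h1 : (a + b) ^ (1 + α) = (a + b) * (a + b) ^ α := by
      rw [Real.rpow_add h0, Real.rpow_one]
    have h2 : ((a + b) / (x + y)) ^ (1 + α) = (a + b) / (x + y) * ((a + b) / (x + y)) ^ α := by
      rw [Real.rpow_add hl, Real.rpow_one]
    rw [h1, h2, Real.rpow_neg hxy.le, Real.div_rpow h0.le hxy.le]
    field_simp
    ring

/-- Up to boundedly many extra points, the points serving two disjoint compact sets can be
separated. -/
theorem exists_split {K K' : Set (Euc d)} (hK : IsCompact K) (hK' : IsCompact K')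
    (hdisj : Disjoint K K') :
    ∃ m : ℕ, ∀ X : Finset (Euc d), ∃ Y Y' : Finset (Euc d), Y.card + Y'.card ≤ X.card + m ∧
      (∀ y ∈ K, Metric.infEDist y (Y : Set (Euc d)) ≤ Metric.infEDist y (X : Set (Euc d))) ∧
      (∀ y ∈ K', Metric.infEDist y (Y' : Set (Euc d)) ≤ Metric.infEDist y (X : Set (Euc d))) := by
  classical
  -- The compact sets are more than r apart. Points closer than r/2 to K are assigned to K, the
  -- others to K'. A point assigned to the wrong side is at distance at least r/2, so a finite
  -- r/2-net F added to both sides replaces it.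
  obtain ⟨r, hr, hsep⟩ := Metric.exists_pos_forall_lt_edist hK hK'.isClosed hdisj
  have hr2 : (0 : ℝ≥0∞) < r / 2 := ENNReal.half_pos (by exact_mod_cast hr.ne')
  obtain ⟨F, hFfin, hF⟩ := EMetric.totallyBounded_iff.1 (hK.union hK').totallyBounded _ hr2
  lift F to Finset (Euc d) using hFfin
  have hFdist : ∀ y ∈ K ∪ K', Metric.infEDist y (F : Set (Euc d)) ≤ r / 2 := by
    intro y hy
    obtain ⟨z, hz, hyz⟩ := Set.mem_iUnion₂.1 (hF hy)
    exact (Metric.infEDist_le_edist_of_mem hz).trans hyz.le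
  refine ⟨2 * F.card, fun X => ?_⟩
  refine ⟨X.filter (fun x => Metric.infEDist x K < r / 2) ∪ F,
    X.filter (fun x => ¬ Metric.infEDist x K < r / 2) ∪ F, ?_, fun y hy => ?_, fun y hy => ?_⟩
  · have h1 := Finset.card_union_le (X.filter (fun x => Metric.infEDist x K < r / 2)) F
    have h2 := Finset.card_union_le (X.filter (fun x => ¬ Metric.infEDist x K < r / 2)) F
    have h3 := Finset.card_filter_add_card_filter_not (s := X)
      (fun x => Metric.infEDist x K < r / 2)
    omega
  · rw [Metric.le_infEDist]
    intro x hx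
    by_cases hP : Metric.infEDist x K < r / 2
    · exact Metric.infEDist_le_edist_of_mem (by simp [hP, Finset.mem_coe.1 hx])
    · refine (Metric.infEDist_anti (s := (F : Set (Euc d))) (by simp)).trans
        ((hFdist y (Or.inl hy)).trans ?_)
      rw [edist_comm]
      exact (not_lt.1 hP).trans (Metric.infEDist_le_edist_of_mem hy)
  · rw [Metric.le_infEDist]
    intro x hx
    by_cases hP : Metric.infEDist x K < r / 2
    · refine (Metric.infEDist_anti (s := (F : Set (Euc d))) (by simp)).trans
        ((hFdist y (Or.inr hy)).trans ?_)
      obtain ⟨z, hz, hxz⟩ := Metric.infEDist_lt_iff.1 hP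
      have h1 := (hsep z hz y hy).le.trans (edist_triangle z x y)
      by_contra hlt
      have h2 : edist z x + edist x y < r / 2 + r / 2 := by
        rw [edist_comm z x, edist_comm x y]
        exact ENNReal.add_lt_add hxz (not_le.1 hlt)
      rw [ENNReal.add_halves] at h2
      exact absurd (h1.trans_lt h2) (lt_irrefl _)
    · exact Metric.infEDist_le_edist_of_mem (by simp [not_lt.1 hP, Finset.mem_coe.1 hx])

theorem exponent_eq (hd : 0 < d) : ((d : ℝ) + p) / d = 1 + p / d := by
  have hd' : (0 : ℝ) < d := by exact_mod_cast hd
  field_simp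

theorem zadorConst_mul_qmass (hd : 0 < d) (hp : 0 < p) {f : Euc d → ℝ≥0∞} {s : ℝ} (hs : 0 ≤ s)
    (hf : ∫⁻ y, f y ^ ((d : ℝ) / (d + p)) = ENNReal.ofReal s) :
    zadorConst d p * qmass p f = ENNReal.ofReal ((zadorConst d p).toReal * s ^ (1 + p / d)) := by
  have hd' : (0 : ℝ) < d := by exact_mod_cast hd
  rw [qmass, hf, exponent_eq hd, ENNReal.ofReal_rpow_of_nonneg hs (by positivity),
    ENNReal.ofReal_mul ENNReal.toReal_nonneg, ENNReal.ofReal_toReal (zadorConst_ne_top hd hp)]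

theorem ofReal_le_qerr_of_le_sqerr {t a : ℝ} (ht : 0 < t) {f : Euc d → ℝ≥0∞}
    (h : ENNReal.ofReal a ≤ sqerr p t f) : ENNReal.ofReal (a * t ^ (-(p / d))) ≤ qerr p t f := by
  calc ENNReal.ofReal (a * t ^ (-(p / d)))
      = ENNReal.ofReal (t ^ (-(p / d))) * ENNReal.ofReal a := by
        rw [mul_comm, ENNReal.ofReal_mul (by positivity)]
    _ ≤ ENNReal.ofReal (t ^ (-(p / d))) * sqerr p t f := by gcongr
    _ = qerr p t f := by
        have := ofReal_rpow_cancel ht (-(p / d)) (qerr p t f)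
        rwa [neg_neg] at this

/-- The lower bound in Zador's formula with a uniform relative error. -/
theorem IsZador.exists_forall_le_qerr (hd : 0 < d) (hp : 0 < p) {f : Euc d → ℝ≥0∞}
    (hf : IsZador p f) {s : ℝ} (hs : 0 ≤ s)
    (hfs : ∫⁻ y, f y ^ ((d : ℝ) / (d + p)) = ENNReal.ofReal s) {ε : ℝ} (hε : 0 < ε) :
    ∃ m : ℝ, 0 < m ∧ ∀ t, m ≤ t → ENNReal.ofReal
      ((1 - ε) * (zadorConst d p).toReal * s ^ (1 + p / d) * t ^ (-(p / d))) ≤ qerr p t f := by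
  have hd' : (0 : ℝ) < d := by exact_mod_cast hd
  rcases hs.eq_or_lt with rfl | hs0
  · refine ⟨1, one_pos, fun t _ => ?_⟩
    rw [Real.zero_rpow (by positivity)]
    simp
  · have hc : 0 < (zadorConst d p).toReal :=
      ENNReal.toReal_pos (zadorConst_ne_zero hd hp) (zadorConst_ne_top hd hp)
    have h1 : ENNReal.ofReal ((1 - ε) * (zadorConst d p).toReal * s ^ (1 + p / d)) <
        zadorConst d p * qmass p f := by
      rw [zadorConst_mul_qmass hd hp hs hfs]
      have h2 : 0 < (zadorConst d p).toReal * s ^ (1 + p / d) := by positivity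
      rw [ENNReal.ofReal_lt_ofReal_iff h2]
      nlinarith
    obtain ⟨m, hm⟩ := eventually_atTop.1 (hf.eventually_const_lt h1)
    refine ⟨max m 1, by positivity, fun t ht => ?_⟩
    have ht0 : 0 < t := by linarith [le_max_right m 1]
    exact ofReal_le_qerr_of_le_sqerr ht0 (hm t ((le_max_left _ _).trans ht)).le

theorem ae_eq_zero_of_lintegral_rpow (hd : 0 < d) (hp : 0 < p) {f : Euc d → ℝ≥0∞}
    (hf : Measurable f) (h : ∫⁻ y, f y ^ ((d : ℝ) / (d + p)) = 0) : f =ᵐ[volume] 0 := by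
  rw [lintegral_eq_zero_iff (hf.pow_const _)] at h
  filter_upwards [h] with y hy
  have := exponent_pos hd hp
  simpa [this, this.le, this.not_gt] using hy

/-- Zador's formula is additive for densities with disjoint compact supports. -/
theorem IsZador.add_of_disjoint (hd : 0 < d) (hp : 0 < p) {f g : Euc d → ℝ≥0∞}
    (hfm : Measurable f) (hgm : Measurable g) (hf : IsZador p f) (hg : IsZador p g)
    {K K' : Set (Euc d)} (hK : IsCompact K) (hK' : IsCompact K') (hdisj : Disjoint K K')
    (hfK : ∀ y ∉ K, f y = 0) (hgK' : ∀ y ∉ K', g y = 0)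
    (hfS : ∫⁻ y, f y ^ ((d : ℝ) / (d + p)) ≠ ∞) (hgS : ∫⁻ y, g y ^ ((d : ℝ) / (d + p)) ≠ ∞) :
    IsZador p (f + g) := by
  have hd' : (0 : ℝ) < d := by exact_mod_cast hd
  have hα : 0 < p / d := by positivity
  set c : ℝ := (zadorConst d p).toReal with hc
  have hc0 : 0 < c :=
    ENNReal.toReal_pos (zadorConst_ne_zero hd hp) (zadorConst_ne_top hd hp)
  set s : ℝ := (∫⁻ y, f y ^ ((d : ℝ) / (d + p))).toReal with hs
  set t : ℝ := (∫⁻ y, g y ^ ((d : ℝ) / (d + p))).toReal with ht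
  have hfs : ∫⁻ y, f y ^ ((d : ℝ) / (d + p)) = ENNReal.ofReal s := (ENNReal.ofReal_toReal hfS).symm
  have hgt : ∫⁻ y, g y ^ ((d : ℝ) / (d + p)) = ENNReal.ofReal t := (ENNReal.ofReal_toReal hgS).symm
  have hs0 : 0 ≤ s := ENNReal.toReal_nonneg
  have ht0 : 0 ≤ t := ENNReal.toReal_nonneg
  rcases hs0.eq_or_lt with hs0 | hs0
  · have h0 := ae_eq_zero_of_lintegral_rpow hd hp hfm (by rw [hfs, ← hs0, ENNReal.ofReal_zero])
    refine hg.congr ?_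
    filter_upwards [h0] with y hy
    simp [hy]
  rcases ht0.eq_or_lt with ht0 | ht0
  · have h0 := ae_eq_zero_of_lintegral_rpow hd hp hgm (by rw [hgt, ← ht0, ENNReal.ofReal_zero])
    refine hf.congr ?_
    filter_upwards [h0] with y hy
    simp [hy]
  have hsum : ∫⁻ y, (f + g) y ^ ((d : ℝ) / (d + p)) = ENNReal.ofReal (s + t) := by
    rw [ENNReal.ofReal_add hs0.le ht0.le, ← hfs, ← hgt, ← lintegral_add_left (hfm.pow_const _)]
    refine lintegral_congr fun y => ?_
    have hq := exponent_pos hd hp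
    by_cases hy : y ∈ K
    · have : g y = 0 := hgK' y (Set.disjoint_left.1 hdisj hy)
      simp [this, hq]
    · simp [hfK y hy, hq]
  have hlim : zadorConst d p * qmass p (f + g) = ENNReal.ofReal (c * (s + t) ^ (1 + p / d)) :=
    zadorConst_mul_qmass hd hp (by positivity) hsum
  have hst : 0 < s + t := by positivity
  unfold IsZador
  rw [hlim]
  refine tendsto_order.2 ⟨fun v hv => ?_, fun v hv => ?_⟩
  · have hε : ∀ᶠ ε : ℝ in 𝓝[>] 0, v < ENNReal.ofReal ((1 - ε) * c * (s + t) ^ (1 + p / d)) := by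
      have h1 : Tendsto (fun ε : ℝ => ENNReal.ofReal ((1 - ε) * c * (s + t) ^ (1 + p / d)))
          (𝓝 0) (𝓝 (ENNReal.ofReal ((1 - 0) * c * (s + t) ^ (1 + p / d)))) := by
        apply ENNReal.tendsto_ofReal
        apply Continuous.tendsto
        fun_prop
      rw [sub_zero, one_mul] at h1
      exact nhdsWithin_le_nhds (h1.eventually_const_lt hv)
    have hε1 : ∀ᶠ ε : ℝ in 𝓝[>] 0, ε < 1 := nhdsWithin_le_nhds (eventually_lt_nhds one_pos)
    obtain ⟨ε, ⟨hε, hε1⟩, hε0⟩ := ((hε.and hε1).and self_mem_nhdsWithin).exists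
    obtain ⟨m₁, hm₁, h₁⟩ := hf.exists_forall_le_qerr hd hp hs0.le hfs hε0
    obtain ⟨m₂, hm₂, h₂⟩ := hg.exists_forall_le_qerr hd hp ht0.le hgt hε0
    obtain ⟨m, hm⟩ := exists_split hK hK' hdisj
    have hlow : ∀ τ : ℝ, 0 < τ → ENNReal.ofReal
        ((1 - ε) * c * (s + t) ^ (1 + p / d) * (τ / (τ + (m + m₁ + m₂))) ^ (p / d)) ≤
        sqerr p τ (f + g) := by
      intro τ hτ
      have h3 : ENNReal.ofReal ((1 - ε) * c * ((s + t) ^ (1 + p / d) *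
          (τ + (m + m₁ + m₂)) ^ (-(p / d)))) ≤ qerr p τ (f + g) := by
        refine le_iInf₂ fun X hX => ?_
        obtain ⟨Y, Y', hcard, hY, hY'⟩ := hm X
        have hcard' : (Y.card : ℝ) + Y'.card ≤ X.card + m := by exact_mod_cast hcard
        have hY0 : (0 : ℝ) ≤ Y.card := Nat.cast_nonneg _
        have hY0' : (0 : ℝ) ≤ Y'.card := Nat.cast_nonneg _
        -- Padding by m₁ and m₂ makes the asymptotic lower bounds valid however few points fall on
        -- one side; the bounded padding disappears as τ → ∞.
        have h4 := h₁ (Y.card + m₁) (by linarith)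
        have h5 := h₂ (Y'.card + m₂) (by linarith)
        have h6 := rpow_add_mul_rpow_neg_le hα hs0.le ht0.le
          (show 0 < Y.card + m₁ by linarith) (show 0 < Y'.card + m₂ by linarith)
        have h7 : (τ + (m + m₁ + m₂)) ^ (-(p / d)) ≤
            (Y.card + m₁ + (Y'.card + m₂)) ^ (-(p / d)) :=
          Real.rpow_le_rpow_of_nonpos (by linarith) (by linarith) (by linarith)
        calc ENNReal.ofReal ((1 - ε) * c * ((s + t) ^ (1 + p / d) *
              (τ + (m + m₁ + m₂)) ^ (-(p / d))))
            ≤ ENNReal.ofReal ((1 - ε) * c * (s ^ (1 + p / d) * (Y.card + m₁) ^ (-(p / d)) +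
              t ^ (1 + p / d) * (Y'.card + m₂) ^ (-(p / d)))) := by
              apply ENNReal.ofReal_le_ofReal
              have : 0 ≤ (1 - ε) * c := mul_nonneg (by linarith) hc0.le
              refine mul_le_mul_of_nonneg_left (le_trans ?_ h6) this
              exact mul_le_mul_of_nonneg_left h7 (by positivity)
          _ ≤ ENNReal.ofReal ((1 - ε) * c * s ^ (1 + p / d) * (Y.card + m₁) ^ (-(p / d))) +
              ENNReal.ofReal ((1 - ε) * c * t ^ (1 + p / d) * (Y'.card + m₂) ^ (-(p / d))) := by
              refine le_trans (le_of_eq ?_) ENNReal.ofReal_add_le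
              congr 1; ring
          _ ≤ qerr p (Y.card + m₁) f + qerr p (Y'.card + m₂) g := add_le_add h4 h5
          _ ≤ (∫⁻ y, Metric.infEDist y (Y : Set (Euc d)) ^ p * f y) +
              ∫⁻ y, Metric.infEDist y (Y' : Set (Euc d)) ^ p * g y :=
              add_le_add (qerr_le f Y (by linarith)) (qerr_le g Y' (by linarith))
          _ ≤ (∫⁻ y, Metric.infEDist y (X : Set (Euc d)) ^ p * f y) +
              ∫⁻ y, Metric.infEDist y (X : Set (Euc d)) ^ p * g y := by
              refine add_le_add (lintegral_mono fun y => ?_) (lintegral_mono fun y => ?_)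
              · by_cases hy : y ∈ K
                · exact mul_le_mul' (ENNReal.rpow_le_rpow (hY y hy) hp.le) le_rfl
                · simp [hfK y hy]
              · by_cases hy : y ∈ K'
                · exact mul_le_mul' (ENNReal.rpow_le_rpow (hY' y hy) hp.le) le_rfl
                · simp [hgK' y hy]
          _ = _ := by
              have hmeas : Measurable fun y => Metric.infEDist y (X : Set (Euc d)) ^ p * f y :=
                (measurable_infEDist_rpow X).mul hfm
              rw [← lintegral_add_left hmeas]
              simp only [Pi.add_apply, mul_add]
      unfold sqerr
      refine le_trans (le_of_eq ?_) (mul_le_mul_right h3 _)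
      rw [← ENNReal.ofReal_mul (by positivity)]
      congr 1
      rw [Real.div_rpow hτ.le (by positivity), Real.rpow_neg (by positivity)]
      ring
    have h8 : Tendsto (fun τ : ℝ => τ / (τ + (m + m₁ + m₂))) atTop (𝓝 1) := by
      have h9 : Tendsto (fun τ : ℝ => 1 - (m + m₁ + m₂) / (τ + (m + m₁ + m₂))) atTop
          (𝓝 (1 - 0)) :=
        tendsto_const_nhds.sub (tendsto_const_nhds.div_atTop
          (tendsto_atTop_add_const_right _ _ tendsto_id))
      rw [sub_zero] at h9
      refine h9.congr' ?_
      filter_upwards [eventually_gt_atTop 0] with τ hτ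
      have : τ + (m + m₁ + m₂) ≠ 0 := by positivity
      field_simp
      ring
    have h10 := ENNReal.tendsto_ofReal ((h8.rpow_const (p := p / d) (Or.inr hα.le)).const_mul
      ((1 - ε) * c * (s + t) ^ (1 + p / d)))
    rw [Real.one_rpow, mul_one] at h10
    filter_upwards [h10.eventually_const_lt hε, eventually_gt_atTop 0] with τ h11 hτ
    exact h11.trans_le (hlow τ hτ)
  -- The proportional division gives equality in the convexity inequality.
  · set θ : ℝ := s / (s + t) with hθ
    have hθ0 : 0 < θ := by positivity
    have hθ' : 1 - θ = t / (s + t) := by rw [hθ]; field_simp; ring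
    have hθ1 : θ < 1 := by
      have : 0 < 1 - θ := by rw [hθ']; positivity
      linarith
    have h1 : Tendsto (fun τ : ℝ => ENNReal.ofReal (θ ^ (-(p / d))) * sqerr p (θ * τ) f +
        ENNReal.ofReal ((1 - θ) ^ (-(p / d))) * sqerr p ((1 - θ) * τ) g) atTop
        (𝓝 (ENNReal.ofReal (c * (s + t) ^ (1 + p / d)))) := by
      have h2 := ENNReal.Tendsto.const_mul (a := ENNReal.ofReal (θ ^ (-(p / d))))
        (hf.comp (tendsto_id.const_mul_atTop hθ0)) (Or.inr ENNReal.ofReal_ne_top)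
      have h3 := ENNReal.Tendsto.const_mul (a := ENNReal.ofReal ((1 - θ) ^ (-(p / d))))
        (hg.comp (tendsto_id.const_mul_atTop (show 0 < 1 - θ by linarith)))
        (Or.inr ENNReal.ofReal_ne_top)
      refine (h2.add h3).trans (le_of_eq ?_)
      have h1t : 0 < 1 - θ := by linarith
      rw [zadorConst_mul_qmass hd hp hs0.le hfs, zadorConst_mul_qmass hd hp ht0.le hgt,
        ← ENNReal.ofReal_mul (by positivity), ← ENNReal.ofReal_mul (by positivity),
        ← ENNReal.ofReal_add (by positivity) (by positivity), hθ', hθ,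
        Real.div_rpow hs0.le hst.le, Real.div_rpow ht0.le hst.le, Real.rpow_neg hs0.le,
        Real.rpow_neg ht0.le, Real.rpow_neg hst.le, Real.rpow_add hs0, Real.rpow_add ht0,
        Real.rpow_add hst, Real.rpow_one, Real.rpow_one, Real.rpow_one]
      congr 2
      have := Real.rpow_pos_of_pos hs0 (p / d)
      have := Real.rpow_pos_of_pos ht0 (p / d)
      have := Real.rpow_pos_of_pos hst (p / d)
      field_simp
      rfl
    filter_upwards [h1.eventually_lt_const hv, eventually_ge_atTop 0] with τ hτ hτ0
    exact (sqerr_add_le hp.le hθ0 hθ1 hτ0 hfm).trans_lt hτ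

/-! ### From cubes to integrable densities -/

theorem indicator_one_rpow {A : Set (Euc d)} {a : ℝ} (ha : 0 < a) :
    (fun y => (A.indicator 1 y : ℝ≥0∞) ^ a) = A.indicator 1 := by
  ext y
  by_cases h : y ∈ A
  · simp [Set.indicator_of_mem h]
  · simp [Set.indicator_of_notMem h, ha]

theorem isCompact_biUnion_cube {s : Finset (Euc d × ℝ)} (hpos : ∀ a ∈ s, 0 < a.2) :
    IsCompact (⋃ a ∈ s, cube a.1 a.2) :=
  s.isCompact_biUnion fun a ha => isCompact_cube a.1 (hpos a ha).le

theorem isZador_biUnion_cube (hd : 0 < d) (hp : 0 < p) (s : Finset (Euc d × ℝ))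
    (hpos : ∀ a ∈ s, 0 < a.2)
    (hdisj : (s : Set (Euc d × ℝ)).PairwiseDisjoint fun a => cube a.1 a.2) :
    IsZador p ((⋃ a ∈ s, cube a.1 a.2).indicator 1) := by
  classical
  have hq := exponent_pos hd hp
  induction s using Finset.induction_on with
  | empty =>
    have : (⋃ a ∈ (∅ : Finset (Euc d × ℝ)), cube a.1 a.2).indicator (1 : Euc d → ℝ≥0∞) = 0 := by
      simp only [Finset.notMem_empty, Set.iUnion_of_empty, Set.iUnion_empty, Set.indicator_empty']
    rw [this]
    exact isZador_zero hd hp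
  | insert a s ha ih =>
    have hpos' : ∀ b ∈ s, 0 < b.2 := fun b hb => hpos b (Finset.mem_insert_of_mem hb)
    have hpa := hpos a (Finset.mem_insert_self _ _)
    have hK := isCompact_biUnion_cube hpos'
    have hKm := hK.measurableSet
    have hd' : Disjoint (cube a.1 a.2) (⋃ b ∈ s, cube b.1 b.2) := by
      rw [Set.disjoint_iUnion₂_right]
      intro b hb
      exact hdisj (by simp) (by simp [hb]) (by rintro rfl; exact ha hb)
    have ih' := ih hpos' (hdisj.subset (by simp))
    rw [Finset.set_biUnion_insert, Set.indicator_union_of_disjoint hd']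
    have := (isZador_cubeInd hd hp a.1 hpa).add_of_disjoint hd hp (measurable_cubeInd _ _)
      (measurable_one.indicator hKm) ih' (isCompact_cube a.1 hpa.le) hK hd'
      (fun y hy => Set.indicator_of_notMem hy _) (fun y hy => Set.indicator_of_notMem hy _)
      (by rw [lintegral_cubeInd_rpow _ _ hq]; exact volume_cube_ne_top _ hpa.le)
      (by rw [indicator_one_rpow hq, lintegral_indicator_one hKm]; exact hK.measure_lt_top.ne)
    exact this

/-- An open set of finite measure is filled, up to small measure, by finitely many disjoint
cubes. -/
theorem exists_finset_cube_filling (hd : 0 < d) {U : Set (Euc d)} (hU : IsOpen U)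
    (hUfin : volume U ≠ ∞) {ε : ℝ≥0∞} (hε : 0 < ε) :
    ∃ s : Finset (Euc d × ℝ), (∀ a ∈ s, 0 < a.2) ∧
      (s : Set (Euc d × ℝ)).PairwiseDisjoint (fun a => cube a.1 a.2) ∧
      (⋃ a ∈ s, cube a.1 a.2) ⊆ U ∧ volume (U \ ⋃ a ∈ s, cube a.1 a.2) < ε := by
  classical
  have hd' : (0 : ℝ) < d := by exact_mod_cast hd
  have hsd : 0 < √(d : ℝ) := Real.sqrt_pos.2 hd'
  have : Nonempty (Fin d) := ⟨⟨0, hd⟩⟩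
  set T : Set (Euc d × ℝ) := {a : Euc d × ℝ | 0 < a.2 ∧ cube a.1 a.2 ⊆ U} with hT
  -- The constant of Vitali's theorem: the cube contains the ball of radius `a.2` and lies in the
  -- one of radius √d `a.2`, so enlarging threefold costs (3√d)^d.
  have hvol : ∀ a ∈ T, volume (Metric.closedBall a.1 (3 * (√d * a.2))) ≤
      (Real.toNNReal ((3 * √d) ^ d) : ℝ≥0∞) * volume (cube a.1 a.2) := by
    intro a ha
    have ha0 : 0 < a.2 := ha.1
    calc volume (Metric.closedBall a.1 (3 * (√d * a.2)))
        = ENNReal.ofReal ((3 * √d) ^ d) * volume (Metric.closedBall a.1 a.2) := by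
          rw [Measure.addHaar_closedBall volume _ (by positivity),
            Measure.addHaar_closedBall volume _ ha0.le, finrank_euclideanSpace_fin, ← mul_assoc 3,
            mul_pow, ENNReal.ofReal_mul (by positivity), mul_assoc]
      _ ≤ _ := by
          gcongr
          · exact le_rfl
          · exact closedBall_subset_cube _ _
  have hint : ∀ a ∈ T, (interior (cube a.1 a.2)).Nonempty := by
    intro a ha
    exact ⟨a.1, interior_mono (closedBall_subset_cube a.1 a.2)
      (Metric.ball_subset_interior_closedBall (Metric.mem_ball_self ha.1))⟩
  have hfine : ∀ x ∈ U, ∀ ε > 0, ∃ a ∈ T, √d * a.2 ≤ ε ∧ a.1 = x := by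
    intro x hx ε hε
    obtain ⟨δ, hδ, hsub⟩ := Metric.nhds_basis_closedBall.mem_iff.1 (hU.mem_nhds hx)
    have hmin : 0 < min δ ε := lt_min hδ hε
    have hE : √(d : ℝ) * (min δ ε / √d) = min δ ε := by field_simp
    refine ⟨(x, min δ ε / √d), ⟨by positivity, ?_⟩, ?_, rfl⟩
    · refine (cube_subset_closedBall x (by positivity)).trans ?_
      rw [hE]
      exact (Metric.closedBall_subset_closedBall (min_le_left _ _)).trans hsub
    · simp only [hE]
      exact min_le_right _ _
  obtain ⟨u, hut, hucount, hudisj, hunull⟩ := Vitali.exists_disjoint_covering_ae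
    (volume : Measure (Euc d)) U T (Real.toNNReal ((3 * √d) ^ d)) (fun a => √d * a.2)
    (fun a => a.1) (fun a => cube a.1 a.2) (fun a ha => cube_subset_closedBall _ ha.1.le) hvol hint
    (fun a _ => isClosed_cube _ _) hfine
  have hsumU : volume U ≤ ∑' a : u, volume (cube a.1.1 a.1.2) := by
    have h1 : volume U ≤ volume (⋃ a ∈ u, cube a.1 a.2) := by
      refine measure_mono_ae ?_
      exact ae_le_set.2 hunull
    exact h1.trans (measure_biUnion_le volume hucount _)
  have h2 : Tendsto (fun s : Finset u => volume U - ∑ a ∈ s, volume (cube a.1.1 a.1.2)) atTop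
      (𝓝 0) := by
    have := ENNReal.Tendsto.sub (tendsto_const_nhds (x := volume U))
      (ENNReal.summable (f := fun a : u => volume (cube a.1.1 a.1.2))).hasSum (Or.inl hUfin)
    rwa [tsub_eq_zero_of_le hsumU] at this
  obtain ⟨s, hs⟩ := (h2.eventually_lt_const hε).exists
  have hmem : ∀ a ∈ s.map (Function.Embedding.subtype _), a ∈ u := by
    intro a ha
    obtain ⟨b, _, rfl⟩ := Finset.mem_map.1 ha
    exact b.2
  have hdisj : ((s.map (Function.Embedding.subtype _) : Finset (Euc d × ℝ)) :
      Set (Euc d × ℝ)).PairwiseDisjoint (fun a => cube a.1 a.2) :=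
    hudisj.subset fun a ha => hmem a ha
  have hsub : (⋃ a ∈ s.map (Function.Embedding.subtype _), cube a.1 a.2) ⊆ U :=
    Set.iUnion₂_subset fun a ha => (hut (hmem a ha)).2
  refine ⟨s.map (Function.Embedding.subtype _), fun a ha => (hut (hmem a ha)).1, hdisj, hsub, ?_⟩
  have hmeas := measure_biUnion_finset (μ := volume) hdisj
    (fun a _ => measurableSet_cube a.1 a.2)
  rw [measure_sdiff hsub ?_ (ne_top_of_le_ne_top hUfin (measure_mono hsub)), hmeas,
    Finset.sum_map]
  · exact hs
  · exact (Finset.measurableSet_biUnion _ fun a _ => measurableSet_cube a.1 a.2).nullMeasurableSet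

/-- Outer regularity replaces B by a slightly larger open W, which finitely many disjoint cubes
nearly fill. The union G of these cubes and B both lie in W, so the indicators of W \ B and W \ G
bound the difference. -/
theorem isZador_indicator_one (hd : 0 < d) (hp : 0 < p) {R : ℝ} (hR : 0 < R) {B : Set (Euc d)}
    (hB : MeasurableSet B) (hBR : B ⊆ cube 0 R) : IsZador p (B.indicator 1) := by
  set R' : ℝ := √d * R + 1 with hR'
  have hR'0 : 0 < R' := by positivity
  have hBball : B ⊆ Metric.ball 0 R' := hBR.trans ((cube_subset_closedBall 0 hR.le).trans
    (Metric.closedBall_subset_ball (by linarith)))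
  have hballR' : Metric.ball (0 : Euc d) R' ⊆ cube 0 R' :=
    Metric.ball_subset_closedBall.trans (closedBall_subset_cube _ _)
  have hBfin : volume B ≠ ∞ := ne_top_of_le_ne_top (volume_cube_ne_top 0 hR.le) (measure_mono hBR)
  refine isZador_of_forall_approx hd hp hR'0 (measurable_one.indicator hB)
    (fun y hy => Set.indicator_of_notMem (fun h => hy (hballR' (hBball h))) _)
    (by rwa [lintegral_indicator_one hB]) fun ε hε => ?_
  have hε2 : 0 < ε / 2 := ENNReal.half_pos hε.ne'
  obtain ⟨U, hBU, hU, hUm⟩ := B.exists_isOpen_lt_add hBfin hε2.ne'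
  set W := U ∩ Metric.ball 0 R' with hW
  have hWo : IsOpen W := hU.inter Metric.isOpen_ball
  have hWR' : W ⊆ cube 0 R' := Set.inter_subset_right.trans hballR'
  have hBW : B ⊆ W := Set.subset_inter hBU hBball
  have hWfin : volume W ≠ ∞ :=
    ne_top_of_le_ne_top (volume_cube_ne_top 0 hR'0.le) (measure_mono hWR')
  obtain ⟨s, hpos, hdisj, hsub, hvol⟩ := exists_finset_cube_filling hd hWo hWfin hε2
  set G := ⋃ a ∈ s, cube a.1 a.2 with hG
  have hGm : MeasurableSet G := (isCompact_biUnion_cube hpos).measurableSet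
  have hWBm : MeasurableSet (W \ B) := hWo.measurableSet.diff hB
  have hWGm : MeasurableSet (W \ G) := hWo.measurableSet.diff hGm
  refine ⟨G.indicator 1, (W \ B).indicator 1 + (W \ G).indicator 1, measurable_one.indicator hGm,
    (measurable_one.indicator hWBm).add (measurable_one.indicator hWGm), fun y hy => ?_,
    fun y => ?_, fun y => ?_, ?_, isZador_biUnion_cube hd hp s hpos hdisj⟩
  · have : y ∉ W := fun h => hy (hWR' h)
    simp [this]
  · by_cases h1 : y ∈ B
    · by_cases h2 : y ∈ G
      · simp [h1, h2]
      · simp [h1, h2, hBW h1]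
    · simp [h1]
  · by_cases h1 : y ∈ G
    · by_cases h2 : y ∈ B
      · simp [h1, h2]
      · simp [h1, h2, hsub h1]
    · simp [h1]
  · simp only [Pi.add_apply]
    rw [lintegral_add_left (measurable_one.indicator hWBm), lintegral_indicator_one hWBm,
      lintegral_indicator_one hWGm, ← ENNReal.add_halves ε]
    refine add_le_add ?_ hvol.le
    refine (measure_mono (Set.sdiff_subset_sdiff_left Set.inter_subset_left)).trans ?_
    rw [measure_sdiff hBU hB.nullMeasurableSet hBfin]
    exact tsub_le_iff_left.2 hUm.le

/-- Inner regularity of the finite measure with density `f` on the cube. -/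
theorem exists_compact_lintegral_diff_le {R : ℝ} {f : Euc d → ℝ≥0∞}
    (hfin : ∫⁻ y in cube (0 : Euc d) R, f y ≠ ∞) {A : Set (Euc d)} (hA : MeasurableSet A)
    (hAR : A ⊆ cube 0 R) {ε : ℝ≥0∞} (hε : 0 < ε) :
    ∃ K ⊆ A, IsCompact K ∧ ∫⁻ y, (A \ K).indicator f y ≤ ε := by
  set μ : Measure (Euc d) := volume.withDensity ((cube 0 R).indicator f) with hμ
  have : IsFiniteMeasure μ := isFiniteMeasure_withDensity
    (by rwa [lintegral_indicator (measurableSet_cube _ _)])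
  obtain ⟨K, hKA, hK, hlt⟩ := hA.exists_isCompact_sdiff_lt (μ := μ) (measure_ne_top _ _) hε.ne'
  refine ⟨K, hKA, hK, le_trans (le_of_eq ?_) hlt.le⟩
  have hm : MeasurableSet (A \ K) := hA.diff hK.measurableSet
  rw [hμ, withDensity_apply _ hm, lintegral_indicator hm]
  refine setLIntegral_congr_fun hm fun y hy => ?_
  rw [Set.indicator_of_mem (hAR hy.1)]

theorem lintegral_indicator_rpow_ne_top (hd : 0 < d) (hp : 0 < p) {R : ℝ} (hR : 0 < R)
    {f : Euc d → ℝ≥0∞} (hf : Measurable f) (hfin : ∫⁻ y in cube (0 : Euc d) R, f y ≠ ∞)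
    {A : Set (Euc d)} (hA : MeasurableSet A) (hAR : A ⊆ cube 0 R) :
    ∫⁻ y, A.indicator f y ^ ((d : ℝ) / (d + p)) ≠ ∞ := by
  have h1 := exponent_lt_one hd hp
  refine ne_top_of_le_ne_top ?_ (lintegral_rpow_le_of_support (R := R) (exponent_pos hd hp)
    h1 (hf.indicator hA)
    fun y hy => Set.indicator_of_notMem (fun h => hy (hAR h)) _)
  refine ENNReal.mul_ne_top (ENNReal.rpow_ne_top_of_nonneg (exponent_pos hd hp).le ?_)
    (ENNReal.rpow_ne_top_of_nonneg (by linarith) (volume_cube_ne_top _ hR.le))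
  rw [lintegral_indicator hA]
  exact ne_top_of_le_ne_top hfin (lintegral_mono_set hAR)

theorem indicator_lintegral_ne_top {R : ℝ} {f : Euc d → ℝ≥0∞}
    (hfin : ∫⁻ y in cube (0 : Euc d) R, f y ≠ ∞) {A : Set (Euc d)} (hA : MeasurableSet A)
    (hAR : A ⊆ cube 0 R) : ∫⁻ y, A.indicator f y ≠ ∞ := by
  rw [lintegral_indicator hA]
  exact ne_top_of_le_ne_top hfin (lintegral_mono_set hAR)

/-- **Zador's theorem** for integrable densities on bounded sets. -/
theorem isZador_indicator (hd : 0 < d) (hp : 0 < p) {R : ℝ} (hR : 0 < R) {f : Euc d → ℝ≥0∞}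
    (hf : Measurable f) : ∫⁻ y in cube (0 : Euc d) R, f y ≠ ∞ →
      ∀ B : Set (Euc d), MeasurableSet B → B ⊆ cube 0 R → IsZador p (B.indicator f) := by
  refine Measurable.ennreal_induction (motive := fun f => ∫⁻ y in cube (0 : Euc d) R, f y ≠ ∞ →
      ∀ B : Set (Euc d), MeasurableSet B → B ⊆ cube 0 R → IsZador p (B.indicator f))
      ?_ ?_ ?_ hf
  · intro c s hs hfin B hB hBR
    have hE : B.indicator (s.indicator fun _ => c) =
        fun y => c * (B ∩ s).indicator (1 : Euc d → ℝ≥0∞) y := by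
      ext y
      rw [Set.indicator_indicator]
      by_cases hy : y ∈ B ∩ s
      · simp only [Set.indicator_of_mem hy, Pi.one_apply, mul_one]
      · simp only [Set.indicator_of_notMem hy, mul_zero]
    have hBs : IsZador p ((B ∩ s).indicator 1) :=
      isZador_indicator_one hd hp hR (hB.inter hs) (Set.inter_subset_left.trans hBR)
    rw [hE]
    -- An infinite value is possible only on a null set, because the integral is finite.
    by_cases hc : c = ∞
    · have h0 : volume (B ∩ s) = 0 := by
        rw [lintegral_indicator_const hs, Measure.restrict_apply hs, hc] at hfin
        by_contra hne
        refine hfin (ENNReal.top_mul ?_)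
        intro h0
        exact hne (measure_mono_null
          (show B ∩ s ⊆ s ∩ cube 0 R from fun y hy => ⟨hy.2, hBR hy.1⟩) h0)
      refine (isZador_zero hd hp).congr ?_
      have : ∀ᵐ y, y ∉ B ∩ s := measure_eq_zero_iff_ae_notMem.1 h0
      filter_upwards [this] with y hy
      simp [Set.indicator_of_notMem hy]
    · exact hBs.const_mul hd hp hc
  · intro f g hdisj hf hg ihf ihg hfin B hB hBR
    have hfin' : (∫⁻ y in cube (0 : Euc d) R, f y) + ∫⁻ y in cube (0 : Euc d) R, g y ≠ ∞ := by
      rw [← lintegral_add_left hf]; exact hfin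
    have hffin := (ENNReal.add_ne_top.1 hfin').1
    have hgfin := (ENNReal.add_ne_top.1 hfin').2
    have hFm : MeasurableSet (B ∩ Function.support f) := hB.inter (measurableSet_support hf)
    have hGm : MeasurableSet (B ∩ Function.support g) := hB.inter (measurableSet_support hg)
    have hFR : B ∩ Function.support f ⊆ cube 0 R := Set.inter_subset_left.trans hBR
    have hGR : B ∩ Function.support g ⊆ cube 0 R := Set.inter_subset_left.trans hBR
    refine isZador_of_forall_approx hd hp hR ((hf.add hg).indicator hB)
      (fun y hy => Set.indicator_of_notMem (fun h => hy (hBR h)) _)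
      (indicator_lintegral_ne_top hfin hB hBR) fun ε hε => ?_
    have hε2 : 0 < ε / 2 := ENNReal.half_pos hε.ne'
    -- Disjoint supports need not be separated; shrinking them to compact subsets of nearly full
    -- mass makes `IsZador.add_of_disjoint` applicable.
    obtain ⟨K, hKF, hK, hKε⟩ := exists_compact_lintegral_diff_le hffin hFm hFR hε2
    obtain ⟨K', hKG, hK', hKε'⟩ := exists_compact_lintegral_diff_le hgfin hGm hGR hε2
    have hKR := hKF.trans hFR
    have hKR' := hKG.trans hGR
    have hKm := hK.measurableSet
    have hKm' := hK'.measurableSet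
    have hKdisj : Disjoint K K' := hdisj.mono (hKF.trans Set.inter_subset_right)
      (hKG.trans Set.inter_subset_right)
    refine ⟨K.indicator f + K'.indicator g, ((B ∩ Function.support f) \ K).indicator f +
      ((B ∩ Function.support g) \ K').indicator g, (hf.indicator hKm).add (hg.indicator hKm'),
      (hf.indicator (hFm.diff hKm)).add (hg.indicator (hGm.diff hKm')), fun y hy => ?_,
      fun y => ?_, fun y => ?_, ?_, ?_⟩
    · have : y ∉ B := fun h => hy (hBR h)
      simp [this]
    · have h1 : B.indicator f y ≤ K.indicator f y +
          ((B ∩ Function.support f) \ K).indicator f y := by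
        by_cases hyB : y ∈ B
        · by_cases hyK : y ∈ K
          · simp [hyB, hyK]
          · by_cases hyf : f y = 0
            · simp [Set.indicator_of_mem hyB, hyf]
            · simp [hyB, hyK, hyf]
        · simp [hyB]
      have h2 : B.indicator g y ≤ K'.indicator g y +
          ((B ∩ Function.support g) \ K').indicator g y := by
        by_cases hyB : y ∈ B
        · by_cases hyK : y ∈ K'
          · simp [hyB, hyK]
          · by_cases hyf : g y = 0
            · simp [Set.indicator_of_mem hyB, hyf]
            · simp [hyB, hyK, hyf]
        · simp [hyB]
      rw [Set.indicator_add']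
      simp only [Pi.add_apply]
      refine (add_le_add h1 h2).trans (le_of_eq ?_)
      abel
    · rw [Set.indicator_add']
      simp only [Pi.add_apply]
      refine le_trans (add_le_add ?_ ?_) le_self_add
      · exact Set.indicator_le_indicator_of_subset (hKF.trans Set.inter_subset_left)
          (fun _ => zero_le) y
      · exact Set.indicator_le_indicator_of_subset (hKG.trans Set.inter_subset_left)
          (fun _ => zero_le) y
    · simp only [Pi.add_apply]
      rw [lintegral_add_left (hf.indicator (hFm.diff hKm)), ← ENNReal.add_halves ε]
      exact add_le_add hKε hKε'
    · exact (ihf hffin K hKm hKR).add_of_disjoint hd hp (hf.indicator hKm) (hg.indicator hKm')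
        (ihg hgfin K' hKm' hKR') hK hK' hKdisj (fun y hy => Set.indicator_of_notMem hy _)
        (fun y hy => Set.indicator_of_notMem hy _)
        (lintegral_indicator_rpow_ne_top hd hp hR hf hffin hKm hKR)
        (lintegral_indicator_rpow_ne_top hd hp hR hg hgfin hKm' hKR')
  · intro f hf hmono ih hfin B hB hBR
    have hsupm : Measurable fun y => ⨆ n, f n y := Measurable.iSup hf
    have hle : ∀ n y, f n y ≤ ⨆ n, f n y := fun n y => le_iSup (fun n => f n y) n
    refine isZador_of_forall_approx hd hp hR (hsupm.indicator hB)
      (fun y hy => Set.indicator_of_notMem (fun h => hy (hBR h)) _)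
      (indicator_lintegral_ne_top hfin hB hBR) fun ε hε => ?_
    have hBfin : ∫⁻ y in B, ⨆ n, f n y ≠ ∞ :=
      ne_top_of_le_ne_top hfin (lintegral_mono_set hBR)
    have hfnfin : ∀ n, ∫⁻ y in cube (0 : Euc d) R, f n y ≠ ∞ := fun n =>
      ne_top_of_le_ne_top hfin (lintegral_mono (hle n))
    have hlim : Tendsto (fun n => ∫⁻ y in B, f n y) atTop (𝓝 (∫⁻ y in B, ⨆ n, f n y)) := by
      rw [lintegral_iSup hf hmono]
      exact tendsto_atTop_iSup fun m n hmn => lintegral_mono (hmono hmn)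
    have hlim' := ENNReal.Tendsto.sub (tendsto_const_nhds (x := ∫⁻ y in B, ⨆ n, f n y)) hlim
      (Or.inl hBfin)
    rw [tsub_self] at hlim'
    obtain ⟨n, hn⟩ := (hlim'.eventually_lt_const hε).exists
    refine ⟨B.indicator (f n), B.indicator fun y => (⨆ n, f n y) - f n y, (hf n).indicator hB,
      (hsupm.sub (hf n)).indicator hB,
      fun y hy => Set.indicator_of_notMem (fun h => hy (hBR h)) _, fun y => ?_, fun y => ?_, ?_,
      ih n (hfnfin n) B hB hBR⟩
    · by_cases hy : y ∈ B
      · simp only [Pi.add_apply, Set.indicator_of_mem hy]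
        exact le_add_tsub
      · simp [hy]
    · by_cases hy : y ∈ B
      · simp only [Pi.add_apply, Set.indicator_of_mem hy]
        exact (hle n y).trans le_self_add
      · simp [hy]
    · rw [lintegral_indicator hB, lintegral_sub (hf n)
        (ne_top_of_le_ne_top hBfin (lintegral_mono (hle n))) (Eventually.of_forall (hle n))]
      exact hn.le

/-! ### Sharp lower bounds determine the shares -/

/-- The tangent lower bounds for η and β at the ratio l = s + t already sum to η + β, so both are
equalities; strictness off the tangency point forces s = ξl. -/
theorem share_eq {α C s t ξ η β : ℝ} (hα : 0 < α) (hC : 0 < C) (hs : 0 < s) (ht : 0 ≤ t)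
    (hξ0 : 0 ≤ ξ) (hξ1 : ξ ≤ 1) (hβ : 0 ≤ β)
    (h1 : C * s ^ (1 + α) ≤ η * ξ ^ α) (h2 : C * t ^ (1 + α) ≤ β * (1 - ξ) ^ α)
    (hsum : η + β = C * (s + t) ^ (1 + α)) :
    ξ = s / (s + t) ∧ η = C * s * (s + t) ^ α := by
  have hl : 0 < s + t := by positivity
  set l := s + t with hldef
  have hlα : l ^ (1 + α) = l * l ^ α := by rw [Real.rpow_add hl, Real.rpow_one]
  have hlpos : 0 < l ^ α := Real.rpow_pos_of_pos hl α
  have hξ : 0 < ξ := by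
    rcases hξ0.eq_or_lt with h | h
    · rw [← h, Real.zero_rpow hα.ne', mul_zero] at h1
      have : 0 < C * s ^ (1 + α) := by positivity
      linarith
    · exact h
  have div1 : ∀ {u z w : ℝ}, 0 < z → C * u ≤ w * z ^ α → C * (u * z ^ (-α)) ≤ w := by
    intro u z w hz h
    rw [Real.rpow_neg hz.le, ← mul_assoc, ← div_eq_mul_inv, div_le_iff₀ (by positivity)]
    exact h
  have hη : C * (s ^ (1 + α) * ξ ^ (-α)) ≤ η := div1 hξ h1
  have hβ' : C * ((1 + α) * (t * l ^ α) - α * ((1 - ξ) * l ^ (1 + α))) ≤ β := by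
    -- If ξ = 1 the second part has no points, and its lower bound forces t = 0.
    rcases hξ1.eq_or_lt with h | h
    · have ht0 : t = 0 := by
        rw [h, sub_self, Real.zero_rpow hα.ne', mul_zero] at h2
        by_contra hne
        have : 0 < t := lt_of_le_of_ne ht (Ne.symm hne)
        have : 0 < C * t ^ (1 + α) := by positivity
        linarith
      rw [ht0, h]
      simpa using hβ
    · refine le_trans ?_ (div1 (by linarith) h2)
      exact mul_le_mul_of_nonneg_left (tangent_le hα ht (by linarith) hl) hC.le
  have htot : C * ((1 + α) * (s * l ^ α) - α * (ξ * l ^ (1 + α))) +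
      C * ((1 + α) * (t * l ^ α) - α * ((1 - ξ) * l ^ (1 + α))) = C * l ^ (1 + α) := by
    rw [hlα]
    have : s = l - t := by rw [hldef]; ring
    rw [this]; ring
  have hsξ : s = ξ * l := by
    by_contra hne
    have h3 := mul_lt_mul_of_pos_left (tangent_lt hα hs.le hξ hl hne) hC
    linarith
  refine ⟨by rw [hsξ]; field_simp, ?_⟩
  have h4 := mul_le_mul_of_nonneg_left (tangent_le hα hs.le hξ hl) hC.le
  have h5 : C * ((1 + α) * (s * l ^ α) - α * (ξ * l ^ (1 + α))) = C * s * l ^ α := by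
    rw [hlα, show ξ * (l * l ^ α) = (ξ * l) * l ^ α by ring, ← hsξ]; ring
  have h6 : C * ((1 + α) * (t * l ^ α) - α * ((1 - ξ) * l ^ (1 + α))) = C * t * l ^ α := by
    rw [hlα, show (1 - ξ) * (l * l ^ α) = (l - ξ * l) * l ^ α by ring, ← hsξ, hldef]; ring
  have h7 : C * l ^ (1 + α) = C * s * l ^ α + C * t * l ^ α := by rw [hlα, hldef]; ring
  linarith

/-- Asymptotically sharp lower bounds on two parts of a minimizing configuration determine the
share of points and of energy of each part. -/
theorem tendsto_share {α C s t : ℝ} (hα : 0 < α) (hC : 0 < C) (hs : 0 < s) (ht : 0 ≤ t)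
    {x a b : ℕ → ℝ} (hx0 : ∀ N, 0 ≤ x N) (hx1 : ∀ N, x N ≤ 1) (ha0 : ∀ N, 0 ≤ a N)
    (hb0 : ∀ N, 0 ≤ b N)
    (ha : ∀ r < C * s ^ (1 + α), ∀ δ > 0, ∀ᶠ N in atTop, r ≤ a N * (x N + δ) ^ α)
    (hb : ∀ r < C * t ^ (1 + α), ∀ δ > 0, ∀ᶠ N in atTop, r ≤ b N * (1 - x N + δ) ^ α)
    (hab : Tendsto (fun N => a N + b N) atTop (𝓝 (C * (s + t) ^ (1 + α)))) :
    Tendsto x atTop (𝓝 (s / (s + t))) ∧ Tendsto a atTop (𝓝 (C * s * (s + t) ^ α)) := by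
  suffices h : Tendsto (fun N => (x N, a N)) atTop
      (𝓝 (s / (s + t), C * s * (s + t) ^ α)) from
    ⟨(continuous_fst.tendsto _).comp h, (continuous_snd.tendsto _).comp h⟩
  -- The pairs (x, a) eventually stay in a compact rectangle, so it suffices to identify the limits
  -- of convergent subsequences; there δ can be sent to 0.
  refine tendsto_of_subseq_tendsto fun ns hns => ?_
  set M := C * (s + t) ^ (1 + α) + 1 with hM
  have hbd : ∀ᶠ n in atTop, (x (ns n), a (ns n)) ∈ Set.Icc (0 : ℝ) 1 ×ˢ Set.Icc (0 : ℝ) M := by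
    filter_upwards [hns.eventually (hab.eventually_lt_const (show _ < M by rw [hM]; linarith))]
      with n hn
    exact ⟨⟨hx0 _, hx1 _⟩, ha0 _, by linarith [hb0 (ns n)]⟩
  obtain ⟨⟨ξ, η⟩, hmem, φ, hφ, hlim⟩ := (isCompact_Icc.prod isCompact_Icc).tendsto_subseq'
    hbd.frequently
  refine ⟨φ, ?_⟩
  have hsub : Tendsto (fun n => ns (φ n)) atTop atTop := hns.comp hφ.tendsto_atTop
  have hxl : Tendsto (fun n => x (ns (φ n))) atTop (𝓝 ξ) := (continuous_fst.tendsto _).comp hlim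
  have hal : Tendsto (fun n => a (ns (φ n))) atTop (𝓝 η) := (continuous_snd.tendsto _).comp hlim
  have hbl : Tendsto (fun n => b (ns (φ n))) atTop (𝓝 (C * (s + t) ^ (1 + α) - η)) := by
    have := (hab.comp hsub).sub hal
    refine this.congr fun n => ?_
    simp
  have key : ∀ {u z : ℕ → ℝ} {v w r₀ : ℝ}, (∀ r < r₀, ∀ δ > 0, ∀ᶠ N in atTop,
      r ≤ u N * (z N + δ) ^ α) → Tendsto (fun n => u (ns (φ n))) atTop (𝓝 v) →
      Tendsto (fun n => z (ns (φ n))) atTop (𝓝 w) → r₀ ≤ v * w ^ α := by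
    intro u z v w r₀ H hu hz
    have h1 : ∀ δ > 0, r₀ ≤ v * (w + δ) ^ α := by
      intro δ hδ
      refine le_of_forall_lt fun r hr => ?_
      obtain ⟨r', hr1, hr2⟩ := exists_between hr
      refine hr1.trans_le (ge_of_tendsto (hu.mul ((hz.add_const δ).rpow_const (Or.inr hα.le)))
        (hsub.eventually (H r' hr2 δ hδ)))
    have h2 : Tendsto (fun δ : ℝ => v * (w + δ) ^ α) (𝓝[>] 0) (𝓝 (v * (w + 0) ^ α)) := by
      refine Tendsto.mono_left ?_ nhdsWithin_le_nhds
      exact (((tendsto_const_nhds.add tendsto_id).rpow_const (Or.inr hα.le)).const_mul v)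
    rw [add_zero] at h2
    exact ge_of_tendsto h2 (by filter_upwards [self_mem_nhdsWithin] with δ hδ using h1 δ hδ)
  have hβ : 0 ≤ C * (s + t) ^ (1 + α) - η := ge_of_tendsto' hbl fun n => hb0 _
  obtain ⟨h1, h2⟩ := share_eq hα hC hs ht hmem.1.1 hmem.1.2 hβ (key ha hal hxl)
    (key hb hbl (hxl.const_sub 1)) (by ring)
  rw [← h1, ← h2]
  exact hlim

/-! ### Voronoi energies as integrals of the distance to X -/

section Voronoi

variable {Ω : Set (Euc d)} {ρ : Euc d → ℝ} {f : Euc d → ℝ≥0∞}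

theorem isClosed_voronoiCell (hΩ : IsCompact Ω) (X : Finset (Euc d)) (x : Euc d) :
    IsClosed (voronoiCell Ω X x) := by
  have : voronoiCell Ω X x = Ω ∩ ⋂ z ∈ X, {y | ‖y - x‖ ≤ ‖y - z‖} := by
    ext y; simp [voronoiCell]
  rw [this]
  refine hΩ.isClosed.inter (isClosed_biInter fun z _ => isClosed_le ?_ ?_) <;> fun_prop

theorem voronoiCell_subset (X : Finset (Euc d)) (x : Euc d) : voronoiCell Ω X x ⊆ Ω :=
  fun _ hy => hy.1

theorem infEDist_eq_of_mem_voronoiCell {X : Finset (Euc d)} {x y : Euc d} (hx : x ∈ X)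
    (hy : y ∈ voronoiCell Ω X x) :
    Metric.infEDist y (X : Set (Euc d)) = ENNReal.ofReal ‖y - x‖ := by
  rw [← dist_eq_norm, ← edist_dist]
  refine le_antisymm (Metric.infEDist_le_edist_of_mem hx) (Metric.le_infEDist.2 fun z hz => ?_)
  rw [edist_dist, edist_dist, dist_eq_norm, dist_eq_norm]
  exact ENNReal.ofReal_le_ofReal (hy.2 z hz)

theorem exists_mem_voronoiCell {X : Finset (Euc d)} (hX : X.Nonempty) {y : Euc d} (hy : y ∈ Ω) :
    ∃ x ∈ X, y ∈ voronoiCell Ω X x := by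
  obtain ⟨x, hx, h⟩ := X.exists_min_image (fun z => ‖y - z‖) hX
  exact ⟨x, hx, hy, h⟩

/-- Two cells meet inside the perpendicular bisector of their generators, a null hyperplane. -/
theorem aedisjoint_voronoiCell {X : Finset (Euc d)} {x x' : Euc d} (hx : x ∈ X) (hx' : x' ∈ X)
    (hne : x ≠ x') : AEDisjoint volume (voronoiCell Ω X x) (voronoiCell Ω X x') := by
  refine measure_mono_null (fun y hy => ?_) (Measure.addHaar_affineSubspace volume
    (AffineSubspace.perpBisector x x') (by rwa [Ne, AffineSubspace.perpBisector_eq_top]))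
  rw [SetLike.mem_coe, AffineSubspace.mem_perpBisector_iff_dist_eq, dist_eq_norm, dist_eq_norm]
  exact le_antisymm (hy.1.2 x' hx') (hy.2.2 x hx)

theorem cellEnergy_nonneg (hρ_pos : ∀ᵐ x ∂(volume.restrict Ω), 0 < ρ x)
    (X : Finset (Euc d)) (x : Euc d) : 0 ≤ cellEnergy Ω ρ p X x := by
  refine integral_nonneg_of_ae ?_
  filter_upwards [ae_restrict_of_ae_restrict_of_subset (voronoiCell_subset X x) hρ_pos] with y hy
  exact mul_nonneg (Real.rpow_nonneg (norm_nonneg _) _) hy.le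

/-- On the cell of x the distance to x is the distance to X, so all cell energies are pieces of a
single integral. Here `f` stands for an `ℝ≥0∞`-valued version of `ρ`. -/
theorem ofReal_cellEnergy (hp : 0 < p) (hΩ : IsCompact Ω) (hρ : IntegrableOn ρ Ω volume)
    (hρ_pos : ∀ᵐ x ∂(volume.restrict Ω), 0 < ρ x)
    (hf : ∀ᵐ x ∂(volume.restrict Ω), f x = ENNReal.ofReal (ρ x))
    {X : Finset (Euc d)} {x : Euc d} (hx : x ∈ X) :
    ENNReal.ofReal (cellEnergy Ω ρ p X x) =
      ∫⁻ y in voronoiCell Ω X x, Metric.infEDist y (X : Set (Euc d)) ^ p * f y := by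
  have hsub := voronoiCell_subset (Ω := Ω) X x
  have hint : IntegrableOn (fun y => ‖y - x‖ ^ p * ρ y) Ω volume := by
    refine hρ.continuousOn_mul ?_ hΩ
    refine Continuous.continuousOn ?_
    exact (continuous_id.sub continuous_const).norm.rpow_const fun _ => Or.inr hp.le
  have hmeas := (isClosed_voronoiCell hΩ X x).measurableSet
  rw [cellEnergy, ofReal_integral_eq_lintegral_ofReal (hint.mono_set hsub)]
  · refine lintegral_congr_ae ?_
    filter_upwards [ae_restrict_of_ae_restrict_of_subset hsub hf, ae_restrict_mem hmeas]
      with y hy hyc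
    rw [infEDist_eq_of_mem_voronoiCell hx hyc, hy,
      ENNReal.ofReal_mul (Real.rpow_nonneg (norm_nonneg _) _),
      ENNReal.ofReal_rpow_of_nonneg (norm_nonneg _) hp.le]
  · filter_upwards [ae_restrict_of_ae_restrict_of_subset hsub hρ_pos] with y hy
    exact mul_nonneg (Real.rpow_nonneg (norm_nonneg _) _) hy.le

theorem ofReal_sum_cellEnergy (hp : 0 < p) (hΩ : IsCompact Ω) (hρ : IntegrableOn ρ Ω volume)
    (hρ_pos : ∀ᵐ x ∂(volume.restrict Ω), 0 < ρ x)
    (hf : ∀ᵐ x ∂(volume.restrict Ω), f x = ENNReal.ofReal (ρ x))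
    {X Y : Finset (Euc d)} (hYX : Y ⊆ X) :
    ENNReal.ofReal (∑ x ∈ Y, cellEnergy Ω ρ p X x) =
      ∫⁻ y in ⋃ x ∈ Y, voronoiCell Ω X x, Metric.infEDist y (X : Set (Euc d)) ^ p * f y := by
  rw [ENNReal.ofReal_sum_of_nonneg fun x _ => cellEnergy_nonneg hρ_pos X x,
    lintegral_biUnion_finset₀ (fun x hx x' hx' hne =>
      aedisjoint_voronoiCell (hYX hx) (hYX hx') hne)
      fun x _ => (isClosed_voronoiCell hΩ X x).measurableSet.nullMeasurableSet]
  exact Finset.sum_congr rfl fun x hx => ofReal_cellEnergy hp hΩ hρ hρ_pos hf (hYX hx)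

theorem ofReal_energy (hp : 0 < p) (hΩ : IsCompact Ω) (hρ : IntegrableOn ρ Ω volume)
    (hρ_pos : ∀ᵐ x ∂(volume.restrict Ω), 0 < ρ x)
    (hf : ∀ᵐ x ∂(volume.restrict Ω), f x = ENNReal.ofReal (ρ x)) (hf0 : ∀ y ∉ Ω, f y = 0)
    {X : Finset (Euc d)} (hX : X.Nonempty) :
    ENNReal.ofReal (energy Ω ρ p X) = ∫⁻ y, Metric.infEDist y (X : Set (Euc d)) ^ p * f y := by
  rw [energy, ofReal_sum_cellEnergy hp hΩ hρ hρ_pos hf subset_rfl]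
  have : ⋃ x ∈ X, voronoiCell Ω X x = Ω := by
    refine Set.Subset.antisymm (Set.iUnion₂_subset fun x _ => voronoiCell_subset X x) fun y hy => ?_
    obtain ⟨x, hx, hyx⟩ := exists_mem_voronoiCell hX hy
    exact Set.mem_biUnion hx hyx
  rw [this, ← lintegral_indicator hΩ.measurableSet]
  refine lintegral_congr fun y => ?_
  by_cases hy : y ∈ Ω
  · rw [Set.indicator_of_mem hy]
  · rw [Set.indicator_of_notMem hy, hf0 y hy, mul_zero]

/-- Reconciles "at most N" with "exactly N": a smaller competitor can be enlarged to N points, which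
only decreases distances. -/
theorem qerr_eq_of_isEnergyMinimizer (hd : 0 < d) (hp : 0 < p) (hΩ : IsCompact Ω)
    (hρ : IntegrableOn ρ Ω volume)
    (hρ_pos : ∀ᵐ x ∂(volume.restrict Ω), 0 < ρ x)
    (hf : ∀ᵐ x ∂(volume.restrict Ω), f x = ENNReal.ofReal (ρ x)) (hf0 : ∀ y ∉ Ω, f y = 0)
    {N : ℕ} (hN : 0 < N) {X : Finset (Euc d)} (hX : IsEnergyMinimizer Ω ρ p N X) :
    qerr p N f = ENNReal.ofReal (energy Ω ρ p X) := by
  have : Nonempty (Fin d) := ⟨⟨0, hd⟩⟩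
  have hXne : X.Nonempty := Finset.card_pos.1 (by rw [hX.card_eq]; exact hN)
  refine le_antisymm ?_ (le_iInf₂ fun Y hY => ?_)
  · rw [ofReal_energy hp hΩ hρ hρ_pos hf hf0 hXne]
    exact qerr_le f X (by rw [hX.card_eq])
  · have : Infinite (Euc d) := Module.Free.infinite ℝ (Euc d)
    obtain ⟨Z, hYZ, hZ⟩ := Infinite.exists_superset_card_eq Y N (by exact_mod_cast hY)
    have hZne : Z.Nonempty := Finset.card_pos.1 (by rw [hZ]; exact hN)
    refine (ENNReal.ofReal_le_ofReal (hX.energy_le Z hZ)).trans ?_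
    rw [ofReal_energy hp hΩ hρ hρ_pos hf hf0 hZne]
    refine lintegral_mono fun y => ?_
    exact mul_le_mul' (ENNReal.rpow_le_rpow (Metric.infEDist_anti (by exact_mod_cast hYZ)) hp.le)
      le_rfl

/-- If the cost tends to zero then the points become dense in the interior of the support. -/
theorem eventually_infEDist_lt (hp : 0 < p) (hfpos : ∀ᵐ x ∂(volume.restrict Ω), 0 < f x)
    (hfm : Measurable f) {X : ℕ → Finset (Euc d)}
    (hE : Tendsto (fun N => ∫⁻ y, Metric.infEDist y (X N : Set (Euc d)) ^ p * f y) atTop (𝓝 0))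
    {K : Set (Euc d)} (hK : IsCompact K) (hKΩ : K ⊆ interior Ω) {δ : ℝ} (hδ : 0 < δ) :
    ∀ᶠ N in atTop, ∀ y ∈ K, Metric.infEDist y (X N : Set (Euc d)) < ENNReal.ofReal δ := by
  obtain ⟨F, hFK, hFfin, hF⟩ := hK.finite_cover_balls (show 0 < δ / 2 by linarith)
  -- If no point is within δ of some y in the ball of radius δ/2 about z, then all points are at
  -- least δ - δ/2 - δ/4 = δ/4 from the ball of radius δ/4 about z. This costs a fixed positive
  -- amount.
  have hmass : ∀ z ∈ F, 0 < ENNReal.ofReal (δ / 4) ^ p * ∫⁻ y in Metric.ball z (δ / 4), f y := by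
    intro z hz
    refine ENNReal.mul_pos (ENNReal.rpow_pos (by simpa using hδ) ENNReal.ofReal_ne_top).ne' ?_
    intro h0
    set S := Metric.ball z (δ / 4) ∩ interior Ω with hS
    have hSo : IsOpen S := Metric.isOpen_ball.inter isOpen_interior
    have hSpos : 0 < volume S :=
      hSo.measure_pos volume ⟨z, Metric.mem_ball_self (by linarith), hKΩ (hFK hz)⟩
    have h1 : ∫⁻ y in S, f y = 0 :=
      le_antisymm (h0 ▸ lintegral_mono_set Set.inter_subset_left) zero_le
    rw [lintegral_eq_zero_iff hfm] at h1
    have h2 := ae_restrict_of_ae_restrict_of_subset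
      (Set.inter_subset_right.trans interior_subset : S ⊆ Ω) hfpos
    have h3 : ∀ᵐ y ∂(volume.restrict S), False := by
      filter_upwards [h1, h2] with y hy1 hy2
      exact hy2.ne' hy1
    rw [eventually_false_iff_eq_bot, ae_eq_bot, Measure.restrict_eq_zero] at h3
    exact hSpos.ne' h3
  have hev : ∀ᶠ N in atTop, ∀ z ∈ F, ∫⁻ y, Metric.infEDist y (X N : Set (Euc d)) ^ p * f y <
      ENNReal.ofReal (δ / 4) ^ p * ∫⁻ y in Metric.ball z (δ / 4), f y :=
    (hFfin.eventually_all).2 fun z hz => hE.eventually_lt_const (hmass z hz)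
  filter_upwards [hev] with N hN y hy
  by_contra hlt
  rw [not_lt] at hlt
  obtain ⟨z, hz, hyz⟩ := Set.mem_iUnion₂.1 (hF hy)
  refine absurd (hN z hz) (not_lt.2 ?_)
  rw [← lintegral_const_mul _ hfm, ← lintegral_indicator Metric.isOpen_ball.measurableSet]
  refine lintegral_mono fun w => ?_
  by_cases hw : w ∈ Metric.ball z (δ / 4)
  · rw [Set.indicator_of_mem hw]
    refine mul_le_mul' (ENNReal.rpow_le_rpow ?_ hp.le) le_rfl
    rw [Metric.le_infEDist]
    intro x hx
    have h1 : ENNReal.ofReal δ ≤ edist y x := hlt.trans (Metric.infEDist_le_edist_of_mem hx)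
    rw [edist_dist] at h1 ⊢
    rw [ENNReal.ofReal_le_ofReal_iff dist_nonneg] at h1
    apply ENNReal.ofReal_le_ofReal
    rw [Metric.mem_ball] at hw hyz
    have h2 := dist_triangle4 y z w x
    rw [dist_comm z w] at h2
    linarith
  · rw [Set.indicator_of_notMem hw]
    exact zero_le

/-- A generator nearest to a point of K lies within δ of K, hence in B. The generators in B
therefore serve K on their own, and their cells cover K. -/
theorem qerr_indicator_le_sum_cellEnergy (hp : 0 < p) (hΩ : IsCompact Ω)
    (hρ : IntegrableOn ρ Ω volume) (hρ_pos : ∀ᵐ x ∂(volume.restrict Ω), 0 < ρ x)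
    (hf : ∀ᵐ x ∂(volume.restrict Ω), f x = ENNReal.ofReal (ρ x))
    {K B : Set (Euc d)} (hKΩ : K ⊆ Ω) {δ : ℝ} (hKB : Metric.thickening δ K ⊆ B)
    {X : Finset (Euc d)}
    (hnear : ∀ y ∈ K, Metric.infEDist y (X : Set (Euc d)) < ENNReal.ofReal δ) :
    qerr p (pointsIn X B).card (K.indicator f) ≤
      ENNReal.ofReal (∑ x ∈ pointsIn X B, cellEnergy Ω ρ p X x) := by
  classical
  have hsubX : pointsIn X B ⊆ X := Finset.filter_subset _ _
  rw [ofReal_sum_cellEnergy hp hΩ hρ hρ_pos hf hsubX,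
    ← lintegral_indicator ((pointsIn X B).measurableSet_biUnion fun x _ =>
      (isClosed_voronoiCell hΩ X x).measurableSet)]
  refine (qerr_le _ (pointsIn X B) le_rfl).trans (lintegral_mono fun y => ?_)
  by_cases hy : y ∈ K
  · have hXne : X.Nonempty := by
      rw [Finset.nonempty_iff_ne_empty]
      rintro rfl
      have := hnear y hy
      simp at this
    obtain ⟨x, hx, hyx⟩ := exists_mem_voronoiCell hXne (hKΩ hy)
    have hd1 := infEDist_eq_of_mem_voronoiCell hx hyx
    have hd2 : edist y x = ENNReal.ofReal ‖y - x‖ := by rw [edist_dist, dist_eq_norm]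
    have hxB : x ∈ B := by
      refine hKB (Metric.mem_thickening_iff_infEDist_lt.2 ?_)
      refine (Metric.infEDist_le_edist_of_mem hy).trans_lt ?_
      rw [edist_comm, hd2, ← hd1]
      exact hnear y hy
    have hxP : x ∈ pointsIn X B := Finset.mem_filter.2 ⟨hx, hxB⟩
    have hyU : y ∈ ⋃ x ∈ pointsIn X B, voronoiCell Ω X x := Set.mem_iUnion₂.2 ⟨x, hxP, hyx⟩
    rw [Set.indicator_of_mem hy, Set.indicator_of_mem hyU, hd1, ← hd2]
    exact mul_le_mul' (ENNReal.rpow_le_rpow (Metric.infEDist_le_edist_of_mem hxP) hp.le) le_rfl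
  · rw [Set.indicator_of_notMem hy, mul_zero]
    exact zero_le

end Voronoi

/-! ### Cubes in arbitrary orientation -/

theorem convex_cube (c : Euc d) (r : ℝ) : Convex ℝ (cube c r) := by
  intro y hy z hz a b ha hb hab i
  have h1 : (a • y + b • z) i - c i = a * (y i - c i) + b * (z i - c i) := by
    simp only [PiLp.add_apply, PiLp.smul_apply, smul_eq_mul]
    linear_combination c i * hab
  rw [h1]
  calc |a * (y i - c i) + b * (z i - c i)| ≤ a * |y i - c i| + b * |z i - c i| := by
        refine (abs_add_le _ _).trans ?_
        rw [abs_mul, abs_mul, abs_of_nonneg ha, abs_of_nonneg hb]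
    _ ≤ a * r + b * r := by gcongr; exacts [hy i, hz i]
    _ = r := by rw [← add_mul, hab, one_mul]

theorem exists_image_cube_of_isCube {A : Set (Euc d)} (hA : IsCube A) :
    ∃ (c : Euc d) (r : ℝ) (φ : Euc d ≃ᵢ Euc d), 0 < r ∧ A = φ '' cube c r := by
  obtain ⟨s, hs, φ, rfl⟩ := hA
  refine ⟨WithLp.toLp 2 fun _ => s / 2, s / 2, φ, by positivity, ?_⟩
  congr 1
  ext y
  simp only [cube, Set.mem_ofPred_eq, Set.mem_Icc, abs_le]
  refine forall_congr' fun i => ?_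
  constructor <;> rintro ⟨h1, h2⟩ <;> constructor <;> linarith

theorem isClosed_of_isCube {A : Set (Euc d)} (hA : IsCube A) : IsClosed A := by
  obtain ⟨c, r, φ, hr, rfl⟩ := exists_image_cube_of_isCube hA
  exact φ.toHomeomorph.isClosedMap _ (isClosed_cube c r)

theorem interior_nonempty_of_isCube {A : Set (Euc d)} (hA : IsCube A) : (interior A).Nonempty := by
  obtain ⟨c, r, φ, hr, rfl⟩ := exists_image_cube_of_isCube hA
  have h : (interior (cube c r)).Nonempty := ⟨c, interior_mono (closedBall_subset_cube c r)
    (Metric.ball_subset_interior_closedBall (Metric.mem_ball_self hr))⟩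
  exact (h.image φ).mono (φ.toHomeomorph.isOpenMap.image_interior_subset _)

/-- A surjective isometry is affine (Mazur–Ulam). Convexity is wanted because it makes the frontier
of A null. -/
theorem convex_of_isCube {A : Set (Euc d)} (hA : IsCube A) : Convex ℝ A := by
  obtain ⟨c, r, φ, hr, rfl⟩ := exists_image_cube_of_isCube hA
  exact (convex_cube c r).affine_image
    (φ.toRealAffineIsometryEquiv.toAffineEquiv : Euc d →ᵃ[ℝ] Euc d)

/-! ### Localization to a cube -/

section Localization

variable {Ω : Set (Euc d)} {ρ : Euc d → ℝ} {f : Euc d → ℝ≥0∞}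

/-- The asymptotically sharp lower bound for the energy of the points in a set `B` containing an
open subset `U` of the domain. -/
theorem eventually_le_energy_part (hd : 0 < d) (hp : 0 < p) (hΩ : IsCompact Ω)
    (hρ : IntegrableOn ρ Ω volume) (hρ_pos : ∀ᵐ x ∂(volume.restrict Ω), 0 < ρ x)
    (hf : ∀ᵐ x ∂(volume.restrict Ω), f x = ENNReal.ofReal (ρ x)) (hfm : Measurable f)
    {R : ℝ} (hR : 0 < R) (hΩR : Ω ⊆ cube 0 R) (hfin : ∫⁻ y in cube (0 : Euc d) R, f y ≠ ∞)
    (hSfin : ∫⁻ y, f y ^ ((d : ℝ) / (d + p)) ≠ ∞)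
    {X : ℕ → Finset (Euc d)}
    (hE : Tendsto (fun N => ∫⁻ y, Metric.infEDist y (X N : Set (Euc d)) ^ p * f y) atTop (𝓝 0))
    {U B : Set (Euc d)} (hU : IsOpen U) (hUΩ : U ⊆ interior Ω) (hUB : U ⊆ B) {r : ℝ}
    (hr : r < (zadorConst d p).toReal *
      (∫⁻ y in U, f y ^ ((d : ℝ) / (d + p))).toReal ^ (1 + p / d)) {δ : ℝ} (hδ : 0 < δ) :
    ∀ᶠ N : ℕ in atTop, r ≤ ((N : ℝ) ^ (p / d) * ∑ x ∈ pointsIn (X N) B, cellEnergy Ω ρ p (X N) x) *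
      ((pointsIn (X N) B).card / (N : ℝ) + δ) ^ (p / d) := by
  have hd' : (0 : ℝ) < d := by exact_mod_cast hd
  have hα : 0 < p / d := by positivity
  have hq := exponent_pos hd hp
  have hc0 : 0 < (zadorConst d p).toReal :=
    ENNReal.toReal_pos (zadorConst_ne_zero hd hp) (zadorConst_ne_top hd hp)
  set q := (d : ℝ) / (d + p) with hqdef
  have hsum0 : ∀ N, 0 ≤ ∑ x ∈ pointsIn (X N) B, cellEnergy Ω ρ p (X N) x := fun N =>
    Finset.sum_nonneg fun x _ => cellEnergy_nonneg hρ_pos (X N) x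
  rcases lt_or_ge r 0 with hr0 | hr0
  · refine Eventually.of_forall fun N => hr0.le.trans ?_
    have := hsum0 N
    positivity
  set μ : Measure (Euc d) := volume.withDensity (fun y => f y ^ q) with hμ
  have hμfin : IsFiniteMeasure μ := isFiniteMeasure_withDensity hSfin
  have hμapply : ∀ {S : Set (Euc d)}, MeasurableSet S → μ S = ∫⁻ y in S, f y ^ q :=
    fun hS => withDensity_apply _ hS
  set σ := (∫⁻ y in U, f y ^ q).toReal with hσ
  have hσpos : 0 < σ := by
    rcases (ENNReal.toReal_nonneg (a := ∫⁻ y in U, f y ^ q)).eq_or_lt with h | h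
    · rw [← hσ] at h
      rw [← h, Real.zero_rpow (by positivity), mul_zero] at hr
      linarith
    · exact h
  -- The strict inequality for r leaves room to replace U by a compact K inside it, which then has a
  -- thickening within U.
  have hσ' : ∃ σ', 0 ≤ σ' ∧ σ' < σ ∧ r < (zadorConst d p).toReal * σ' ^ (1 + p / d) := by
    have h1 : Tendsto (fun z : ℝ => (zadorConst d p).toReal * z ^ (1 + p / d)) (𝓝[<] σ)
        (𝓝 ((zadorConst d p).toReal * σ ^ (1 + p / d))) :=
      ((tendsto_id.mono_left nhdsWithin_le_nhds).rpow_const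
        (Or.inr (by positivity))).const_mul _
    obtain ⟨z, ⟨hz1, hz2⟩, hz3⟩ := ((h1.eventually_const_lt hr).and self_mem_nhdsWithin).and
      (nhdsWithin_le_nhds (lt_mem_nhds hσpos)) |>.exists
    exact ⟨z, le_of_lt hz3, hz2, hz1⟩
  obtain ⟨σ', hσ'0, hσ'σ, hrσ'⟩ := hσ'
  have hlt : ENNReal.ofReal σ' < μ U := by
    rw [hμapply hU.measurableSet]
    refine (ENNReal.ofReal_lt_iff_lt_toReal hσ'0 ?_).2 hσ'σ
    rw [← hμapply hU.measurableSet]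
    exact measure_ne_top _ _
  obtain ⟨K, hKU, hK, hσK⟩ := hU.exists_lt_isCompact hlt
  have hKΩ : K ⊆ Ω := hKU.trans (hUΩ.trans interior_subset)
  have hKm := hK.measurableSet
  set κ := (μ K).toReal with hκ
  have hκσ : σ' < κ := (ENNReal.ofReal_lt_iff_lt_toReal hσ'0 (measure_ne_top _ _)).1 hσK
  have hZ : IsZador p (K.indicator f) :=
    isZador_indicator hd hp hR hfm hfin K hKm (hKΩ.trans hΩR)
  have hSK : ∫⁻ y, K.indicator f y ^ q = ENNReal.ofReal κ := by
    rw [hκ, ENNReal.ofReal_toReal (measure_ne_top _ _), hμapply hKm, ← lintegral_indicator hKm]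
    refine lintegral_congr fun y => ?_
    by_cases hy : y ∈ K
    · simp [hy]
    · simp [hy, hq]
  have hrK : ENNReal.ofReal r < zadorConst d p * qmass p (K.indicator f) := by
    have hκ0 : 0 < κ := by linarith
    rw [zadorConst_mul_qmass hd hp (by linarith) hSK, ENNReal.ofReal_lt_ofReal_iff (by positivity)]
    refine hrσ'.trans_le ?_
    gcongr
  obtain ⟨τ₀, hτ₀⟩ := eventually_atTop.1 (hZ.eventually_const_lt hrK)
  obtain ⟨η, hη, hηU⟩ := hK.exists_thickening_subset_open hU hKU
  have hfpos : ∀ᵐ x ∂(volume.restrict Ω), 0 < f x := by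
    filter_upwards [hf, hρ_pos] with x hx1 hx2
    rw [hx1]
    exact ENNReal.ofReal_pos.2 hx2
  have hNδ : Tendsto (fun N : ℕ => δ * (N : ℝ)) atTop atTop :=
    tendsto_natCast_atTop_atTop.const_mul_atTop hδ
  filter_upwards [eventually_infEDist_lt hp hfpos hfm hE hK (hKU.trans hUΩ) hη,
    hNδ.eventually_ge_atTop τ₀, eventually_gt_atTop 0] with N hnear hNτ hN
  have hN' : (0 : ℝ) < N := by exact_mod_cast hN
  have hcard0 : (0 : ℝ) ≤ (pointsIn (X N) B).card := Nat.cast_nonneg _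
  have h1 := qerr_indicator_le_sum_cellEnergy hp hΩ hρ hρ_pos hf hKΩ (hηU.trans hUB) hnear
  -- The slack δN keeps the number of points above the threshold τ₀ even if few of them lie in B.
  have h2 := (hτ₀ ((pointsIn (X N) B).card + δ * N) (by linarith)).le
  have h3 : ENNReal.ofReal r ≤ ENNReal.ofReal (((pointsIn (X N) B).card + δ * N) ^ (p / d) *
      ∑ x ∈ pointsIn (X N) B, cellEnergy Ω ρ p (X N) x) := by
    rw [ENNReal.ofReal_mul (by positivity)]
    refine h2.trans ?_
    unfold sqerr
    gcongr
    exact (qerr_anti (by nlinarith) _).trans h1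
  rw [ENNReal.ofReal_le_ofReal_iff (mul_nonneg (by positivity) (hsum0 N))] at h3
  refine h3.trans (le_of_eq ?_)
  rw [mul_right_comm, ← Real.mul_rpow hN'.le (by positivity)]
  congr 2
  field_simp

theorem card_pointsIn_add_compl (X : Finset (Euc d)) (A : Set (Euc d)) :
    (pointsIn X A).card + (pointsIn X Aᶜ).card = X.card := by
  classical
  have := Finset.card_filter_add_card_filter_not (s := X) (fun x => x ∈ A)
  unfold pointsIn
  convert this

theorem sum_pointsIn_add_compl (X : Finset (Euc d)) (A : Set (Euc d)) (g : Euc d → ℝ) :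
    ∑ x ∈ pointsIn X A, g x + ∑ x ∈ pointsIn X Aᶜ, g x = ∑ x ∈ X, g x := by
  classical
  have := Finset.sum_filter_add_sum_filter_not X (fun x => x ∈ A) g
  unfold pointsIn
  convert this

theorem tendsto_averageEnergy (hd : 0 < d) (hp : 0 < p) (hΩ : IsCompact Ω) (hΩ_convex : Convex ℝ Ω)
    (hρ : IntegrableOn ρ Ω volume) (hρ_pos : ∀ᵐ x ∂(volume.restrict Ω), 0 < ρ x)
    (hf : ∀ᵐ x ∂(volume.restrict Ω), f x = ENNReal.ofReal (ρ x)) (hfm : Measurable f)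
    (hf0 : ∀ y ∉ Ω, f y = 0) {X : ℕ → Finset (Euc d)}
    (hX : ∀ N : ℕ, IsEnergyMinimizer Ω ρ p N (X N)) {A : Set (Euc d)} (hA : IsCube A)
    (hAΩ : A ⊆ Ω) :
    (∀ᶠ N : ℕ in atTop, (pointsIn (X N) A).Nonempty) ∧
      Tendsto (fun N : ℕ => averageEnergy Ω ρ p (X N) A * (N : ℝ) ^ (((d : ℝ) + p) / (d : ℝ)))
        atTop (𝓝 ((zadorConst d p).toReal *
          (∫⁻ y, f y ^ ((d : ℝ) / (d + p))).toReal ^ (1 + p / d))) := by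
  have hd' : (0 : ℝ) < d := by exact_mod_cast hd
  have hα : 0 < p / d := by positivity
  have hq := exponent_pos hd hp
  have hq1 := exponent_lt_one hd hp
  have hc0 : 0 < (zadorConst d p).toReal :=
    ENNReal.toReal_pos (zadorConst_ne_zero hd hp) (zadorConst_ne_top hd hp)
  set c := (zadorConst d p).toReal with hc
  set q := (d : ℝ) / (d + p) with hqdef
  obtain ⟨R₀, hR₀⟩ := hΩ.isBounded.subset_closedBall (0 : Euc d)
  set R := max R₀ 1 with hRdef
  have hR : 0 < R := lt_of_lt_of_le one_pos (le_max_right _ _)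
  have hΩR : Ω ⊆ cube 0 R := hR₀.trans ((Metric.closedBall_subset_closedBall (le_max_left _ _)).trans
    (closedBall_subset_cube _ _))
  have hfR : ∀ y ∉ cube (0 : Euc d) R, f y = 0 := fun y hy => hf0 y fun h => hy (hΩR h)
  have hind : Ω.indicator f = f := by
    ext y
    by_cases hy : y ∈ Ω
    · simp [hy]
    · simp [hy, hf0 y hy]
  have hff : ∫⁻ y, f y ≠ ∞ := by
    rw [← hind, lintegral_indicator hΩ.measurableSet, lintegral_congr_ae hf]
    exact hρ.lintegral_lt_top.ne
  have hfin : ∫⁻ y in cube (0 : Euc d) R, f y ≠ ∞ :=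
    ne_top_of_le_ne_top hff (setLIntegral_le_lintegral _ _)
  have hSfin : ∫⁻ y, f y ^ q ≠ ∞ := by
    have := lintegral_indicator_rpow_ne_top hd hp hR hfm hfin hΩ.measurableSet hΩR
    rwa [hind] at this
  have hZ : IsZador p f := by
    have := isZador_indicator hd hp hR hfm hfin Ω hΩ.measurableSet hΩR
    rwa [hind] at this
  set lam := (∫⁻ y, f y ^ q).toReal with hlam
  have hlam0 : 0 ≤ lam := ENNReal.toReal_nonneg
  have hlamE : ∫⁻ y, f y ^ q = ENNReal.ofReal lam := (ENNReal.ofReal_toReal hSfin).symm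
  have henergy0 : ∀ N, 0 ≤ energy Ω ρ p (X N) := fun N =>
    Finset.sum_nonneg fun x _ => cellEnergy_nonneg hρ_pos (X N) x
  -- the total energy
  have htot : Tendsto (fun N : ℕ => (N : ℝ) ^ (p / d) * energy Ω ρ p (X N)) atTop
      (𝓝 (c * lam ^ (1 + p / d))) := by
    have h1 := hZ.comp tendsto_natCast_atTop_atTop
    rw [zadorConst_mul_qmass hd hp hlam0 hlamE] at h1
    have h2 := (ENNReal.tendsto_toReal ENNReal.ofReal_ne_top).comp h1
    rw [ENNReal.toReal_ofReal (by positivity)] at h2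
    refine h2.congr' ?_
    filter_upwards [eventually_gt_atTop 0] with N hN
    simp only [Function.comp_apply, sqerr]
    rw [qerr_eq_of_isEnergyMinimizer hd hp hΩ hρ hρ_pos hf hf0 hN (hX N),
      ← ENNReal.ofReal_mul (by positivity), ENNReal.toReal_ofReal]
    exact mul_nonneg (by positivity) (henergy0 N)
  have hE : Tendsto (fun N => ∫⁻ y, Metric.infEDist y (X N : Set (Euc d)) ^ p * f y) atTop
      (𝓝 0) := by
    have h1 : Tendsto (fun N : ℕ => (N : ℝ) ^ (-(p / d))) atTop (𝓝 0) :=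
      (tendsto_rpow_neg_atTop hα).comp tendsto_natCast_atTop_atTop
    have h2 := ENNReal.tendsto_ofReal (h1.mul htot)
    rw [zero_mul, ENNReal.ofReal_zero] at h2
    refine h2.congr' ?_
    filter_upwards [eventually_gt_atTop 0] with N hN
    have hN' : (0 : ℝ) < N := by exact_mod_cast hN
    rw [← mul_assoc, ← Real.rpow_add hN', neg_add_cancel, Real.rpow_zero, one_mul]
    exact ofReal_energy hp hΩ hρ hρ_pos hf hf0
      (Finset.card_pos.1 (by rw [(hX N).card_eq]; exact hN))
  -- the two parts of the domain
  have hAint : interior A ⊆ interior Ω := interior_mono hAΩ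
  have hV : IsOpen (interior Ω \ A) := isOpen_interior.sdiff (isClosed_of_isCube hA)
  set s := (∫⁻ y in interior A, f y ^ q).toReal with hs
  set t := (∫⁻ y in interior Ω \ A, f y ^ q).toReal with ht
  have hsfin : ∫⁻ y in interior A, f y ^ q ≠ ∞ :=
    ne_top_of_le_ne_top hSfin (setLIntegral_le_lintegral _ _)
  have htfin : ∫⁻ y in interior Ω \ A, f y ^ q ≠ ∞ :=
    ne_top_of_le_ne_top hSfin (setLIntegral_le_lintegral _ _)
  -- Only the frontiers of A and Ω are lost, and frontiers of convex sets are null.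
  have hst : s + t = lam := by
    rw [hs, ht, hlam, ← ENNReal.toReal_add hsfin htfin]
    congr 1
    rw [← lintegral_union hV.measurableSet
      (Set.disjoint_left.2 fun y hy hy' => hy'.2 (interior_subset hy)),
      ← lintegral_indicator (isOpen_interior.union hV).measurableSet]
    refine lintegral_congr_ae ?_
    have h1 : ∀ᵐ y, y ∉ frontier A :=
      measure_eq_zero_iff_ae_notMem.1 (Convex.addHaar_frontier volume (convex_of_isCube hA))
    have h2 : ∀ᵐ y, y ∉ frontier Ω :=
      measure_eq_zero_iff_ae_notMem.1 (Convex.addHaar_frontier volume hΩ_convex)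
    filter_upwards [h1, h2] with y hy1 hy2
    by_cases hy : y ∈ Ω
    · refine Set.indicator_of_mem ?_ _
      by_cases hyA : y ∈ A
      · left
        by_contra h
        exact hy1 ⟨subset_closure hyA, h⟩
      · right
        refine ⟨?_, hyA⟩
        by_contra h
        exact hy2 ⟨subset_closure hy, h⟩
    · rw [hf0 y hy, ENNReal.zero_rpow_of_pos hq]
      exact Set.indicator_apply_eq_zero.2 fun _ => by rw [hf0 y hy, ENNReal.zero_rpow_of_pos hq]
  have hs0 : 0 < s := by
    refine ENNReal.toReal_pos ?_ hsfin
    intro h0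
    rw [lintegral_eq_zero_iff (hfm.pow_const q)] at h0
    have h1 := ae_restrict_of_ae_restrict_of_subset (interior_subset.trans hAΩ) hρ_pos
    have h2 := ae_restrict_of_ae_restrict_of_subset (interior_subset.trans hAΩ) hf
    have h3 : ∀ᵐ y ∂(volume.restrict (interior A)), False := by
      filter_upwards [h0, h1, h2] with y hy0 hy1 hy2
      have h4 : f y = 0 := by simpa [hq, hq.le, hq.not_gt] using hy0
      rw [hy2, ENNReal.ofReal_eq_zero] at h4
      linarith
    rw [eventually_false_iff_eq_bot, ae_eq_bot, Measure.restrict_eq_zero] at h3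
    exact (isOpen_interior.measure_pos volume (interior_nonempty_of_isCube hA)).ne' h3
  have ht0 : 0 ≤ t := ENNReal.toReal_nonneg
  have hpart0 : ∀ (B : Set (Euc d)) (N : ℕ),
      0 ≤ (N : ℝ) ^ (p / d) * ∑ x ∈ pointsIn (X N) B, cellEnergy Ω ρ p (X N) x := fun B N =>
    mul_nonneg (by positivity) (Finset.sum_nonneg fun x _ => cellEnergy_nonneg hρ_pos (X N) x)
  have hcard : ∀ N : ℕ, ((pointsIn (X N) A).card : ℝ) + (pointsIn (X N) Aᶜ).card = N := fun N => by
    have := card_pointsIn_add_compl (X N) A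
    rw [(hX N).card_eq] at this
    exact_mod_cast this
  obtain ⟨hx, ha⟩ := tendsto_share (C := c) (s := s) (t := t) hα hc0 hs0 ht0
    (x := fun N : ℕ => (pointsIn (X N) A).card / (N : ℝ))
    (a := fun N : ℕ => (N : ℝ) ^ (p / d) * ∑ x ∈ pointsIn (X N) A, cellEnergy Ω ρ p (X N) x)
    (b := fun N : ℕ => (N : ℝ) ^ (p / d) * ∑ x ∈ pointsIn (X N) Aᶜ, cellEnergy Ω ρ p (X N) x)
    (fun N => div_nonneg (Nat.cast_nonneg _) (Nat.cast_nonneg _))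
    (fun N => div_le_one_of_le₀ (by
      have := hcard N
      have : (0 : ℝ) ≤ (pointsIn (X N) Aᶜ).card := Nat.cast_nonneg _
      linarith) (Nat.cast_nonneg N))
    (hpart0 A) (hpart0 Aᶜ)
    (fun r hr δ hδ => eventually_le_energy_part hd hp hΩ hρ hρ_pos hf hfm hR hΩR hfin hSfin hE
      isOpen_interior hAint interior_subset hr hδ)
    (fun r hr δ hδ => by
      filter_upwards [eventually_le_energy_part hd hp hΩ hρ hρ_pos hf hfm hR hΩR hfin hSfin hE
        hV Set.sdiff_subset (B := Aᶜ) (fun y hy => hy.2) hr hδ, eventually_gt_atTop 0] with N h hN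
      have hN' : (0 : ℝ) < N := by exact_mod_cast hN
      have : 1 - ((pointsIn (X N) A).card : ℝ) / N = (pointsIn (X N) Aᶜ).card / N := by
        rw [eq_div_iff hN'.ne', sub_mul, one_mul, div_mul_cancel₀ _ hN'.ne']
        linarith [hcard N]
      rw [this]
      exact h)
    (by
      rw [hst]
      refine htot.congr fun N => ?_
      rw [← mul_add, sum_pointsIn_add_compl]
      rfl)
  have hlampos : 0 < s + t := by positivity
  have hx0 : 0 < s / (s + t) := by positivity
  refine ⟨?_, ?_⟩
  · filter_upwards [hx.eventually_const_lt hx0] with N hN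
    rw [← Finset.card_pos]
    by_contra h
    rw [not_lt, Nat.le_zero] at h
    simp [h] at hN
  · have h1 := ha.div hx hx0.ne'
    -- The mass s of A cancels between energy and number of points, so the limit does not see A.
    have h2 : c * s * (s + t) ^ (p / d) / (s / (s + t)) = c * lam ^ (1 + p / d) := by
      rw [← hst, Real.rpow_add hlampos, Real.rpow_one]
      field_simp
    rw [h2] at h1
    refine h1.congr' ?_
    filter_upwards [eventually_gt_atTop 0] with N hN
    have hN' : (0 : ℝ) < N := by exact_mod_cast hN
    rw [averageEnergy, exponent_eq hd, Real.rpow_add hN', Real.rpow_one]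
    simp only [Pi.div_apply]
    rw [div_div_eq_mul_div]
    ring

end Localization

end Quantization

end

theorem mainTheorem5 (d : ℕ) (hd : 0 < d) (p : ℝ) (hp : 1 ≤ p)
    (Ω : Set (EuclideanSpace ℝ (Fin d))) (hΩ_compact : IsCompact Ω) (hΩ_convex : Convex ℝ Ω)
    (ρ : EuclideanSpace ℝ (Fin d) → ℝ) (hρ_int : IntegrableOn ρ Ω volume)
    (hρ_pos : ∀ᵐ x ∂(volume.restrict Ω), 0 < ρ x)
    (X : ℕ → Finset (EuclideanSpace ℝ (Fin d)))
    (hX : ∀ N : ℕ, IsEnergyMinimizer Ω ρ p N (X N)) :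
    ∃ L : ℝ, ∀ A : Set (EuclideanSpace ℝ (Fin d)), IsCube A → A ⊆ Ω →
      (∀ᶠ N : ℕ in atTop, (pointsIn (X N) A).Nonempty) ∧
      Tendsto (fun N : ℕ => averageEnergy Ω ρ p (X N) A * (N : ℝ) ^ (((d : ℝ) + p) / (d : ℝ)))
        atTop (𝓝 L) := by
  have hmeas := hρ_int.aestronglyMeasurable.aemeasurable
  -- The density is replaced by a measurable representative, extended by zero outside Ω.
  have hf : ∀ᵐ x ∂(volume.restrict Ω),
      Ω.indicator (fun y => ENNReal.ofReal (hmeas.mk ρ y)) x = ENNReal.ofReal (ρ x) := by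
    filter_upwards [hmeas.ae_eq_mk, ae_restrict_mem hΩ_compact.measurableSet] with x hx hxΩ
    rw [Set.indicator_of_mem hxΩ, hx]
  exact ⟨_, fun A hA hAΩ => Quantization.tendsto_averageEnergy hd (by linarith) hΩ_compact
    hΩ_convex hρ_int hρ_pos hf
    (hmeas.measurable_mk.ennreal_ofReal.indicator hΩ_compact.measurableSet)
    (fun y hy => Set.indicator_of_notMem hy _) hX hA hAΩ⟩
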